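/- Let $M$ be a compact strictly pseudoconvex CR manifold of CR dimension $n$ (real dimension $2n+1$), with a contact form $\theta$, $H(M)=\operatorname{Ker}\theta$, whose Levi form $G_\theta(X,Y)=(d\theta)(X,JY)$ is positive definite on $H(M)$, where $2\,d\theta(X,Y)=X(\theta(Y))-Y(\theta(X))-\theta([X,Y])$. Let $T$ be the vector field with $\theta(T)=1$ and $d\theta(T,\cdot)=0$. Extend $J$ to $T(M)$ by $JT=0$, and let $g_\theta$ be the Webster metric, which equals $G_\theta$ on $H(M)$ and for which $T$ is a unit vector orthogonal to $H(M)$. Let $\nabla$ be the Tanaka–Webster connection of $(M,\theta)$, i.e. the unique linear connection such that $H(M)$ is $\nabla$-parallel, $\nabla g_\theta=0$, $\nabla J=0$, and its torsion satisfies $T_\nabla(Z,W)=0$ and $T_\nabla(Z,\overline W)=2i\,G_\theta(Z,\overline W)\,T$ for $Z,W\in T_{1,0}(M)$ and $\tau\circ J+J\circ\tau=0$, where $\tau(X)=T_\nabla(T,X)$. Assume that $(M,\theta)$ is Sasakian, i.e. $\tau=0$. A piecewise $C^1$ curve $\gamma$ is called lengthy if $\dot\gamma(t)\in H(M)$ wherever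 $\dot\gamma(t)$ is defined; its length is $\int G_\theta(\dot\gamma,\dot\gamma)^{1/2}\,dt$, and the Carnot–Carathéodory distance $\rho(x,y)$ is the infimum of the lengths of the lengthy curves joining $x$ and $y$. Let $c>0$, $x_0\in M$, and put $B(x_0,R)=\{x\in M:\rho(x_0,x)<R\}$ and $N(x_0,R)=\{w\in H(M)_{x_0}: G_\theta(w,w)^{1/2}<R\}$. Suppose that every $x\in B(x_0,\pi/\sqrt c)$ can be joined to $x_0$ by a lengthy geodesic of $\nabla$ (a lengthy curve with $\nabla_{\dot\gamma}\dot\gamma=0$) whose length is $\rho(x_0,x)$. Then the exponential map $\exp_{x_0}$ of $\nabla$ is well defined on $N(x_0,\pi/\sqrt c)$ (for each $w$ in this disc there is exactly one geodesic $\gamma:\mathbb R\to M$ of $\nabla$ with $\gamma(0)=x_0$, $\dot\gamma(0)=w$, and $\exp_{x_0}(w)=\gamma(1)$), it maps $N(x_0,\pi/\sqrt c)$ into $B(x_0,\pi/\sqrt c)$, and $\exp_{x_0}:N(x_0,\pi/\sqrt c)\to B(x_0,\pi/\sqrt c)$ is surjective. -/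

import Mathlib

open Set Bundle Manifold
open scoped ContDiff ENNReal

noncomputable section

/-! ### Differential forms and vector fields -/

section Basic

variable {n : ℕ} {M : Type*} [TopologicalSpace M]
  [ChartedSpace (EuclideanSpace ℝ (Fin (2 * n + 1))) M]
  [IsManifold (𝓡 (2 * n + 1)) ∞ M]

/-- The exterior derivative of a `1`-form `θ` on a `(2n+1)`-dimensional manifold, with the
normalization `2 dθ(X, Y) = X(θ(Y)) - Y(θ(X)) - θ([X, Y])` (the one for which
`T_∇(Z, W̄) = 2 i G_θ(Z, W̄) T`). The right-hand side is tensorial, so it may be computed with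
arbitrary local extensions of the two tangent vectors. -/
def dForm (θ : ∀ x : M, TangentSpace (𝓡 (2 * n + 1)) x →L[ℝ] ℝ) (x : M)
    (v w : TangentSpace (𝓡 (2 * n + 1)) x) : ℝ :=
  let X := FiberBundle.extend (EuclideanSpace ℝ (Fin (2 * n + 1))) v
  let Y := FiberBundle.extend (EuclideanSpace ℝ (Fin (2 * n + 1))) w
  (1 / 2) * (mvfderiv (𝓡 (2 * n + 1)) (fun y => θ y (Y y)) x v
    - mvfderiv (𝓡 (2 * n + 1)) (fun y => θ y (X y)) x w
    - θ x (VectorField.mlieBracket (𝓡 (2 * n + 1)) X Y x))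

/-- The characteristic direction `T` of `dθ`: the unique vector field with `θ(T) = 1` and
`T ⌟ dθ = 0`. -/
def charDirection (θ : ∀ x : M, TangentSpace (𝓡 (2 * n + 1)) x →L[ℝ] ℝ) (x : M) :
    TangentSpace (𝓡 (2 * n + 1)) x :=
  @Classical.epsilon _ ⟨0⟩ fun v : TangentSpace (𝓡 (2 * n + 1)) x =>
    θ x v = 1 ∧ ∀ w, dForm θ x v w = 0

/-- Smoothness (class `C^∞`) of a vector field on a `(2n+1)`-dimensional manifold. -/
def SmoothField (X : ∀ x : M, TangentSpace (𝓡 (2 * n + 1)) x) : Prop :=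
  ContMDiff (𝓡 (2 * n + 1)) (𝓡 (2 * n + 1)).tangent ∞
    (fun x => (⟨x, X x⟩ : TangentBundle (𝓡 (2 * n + 1)) M))

/-- The velocity `γ'(t)` of a curve. -/
def velocity (γ : ℝ → M) (t : ℝ) : TangentSpace (𝓡 (2 * n + 1)) (γ t) :=
  mfderiv 𝓘(ℝ, ℝ) (𝓡 (2 * n + 1)) γ t (1 : ℝ)

end Basic

/-! ### Strictly pseudoconvex CR manifolds with a fixed contact form -/

/-- A strictly pseudoconvex CR structure of CR dimension `n` on the `(2n+1)`-dimensional smooth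
manifold `M`, together with a contact form `θ` whose Levi form is positive definite.
The Levi distribution is `H(M) = Ker θ`, and the CR structure is
`T_{1,0}(M) = {X - i J X : X ∈ H(M)}`; as usual `J` is extended to `T(M)` by `J T = 0`. -/
structure PseudohermitianStructure (n : ℕ) (M : Type*) [TopologicalSpace M]
    [ChartedSpace (EuclideanSpace ℝ (Fin (2 * n + 1))) M]
    [IsManifold (𝓡 (2 * n + 1)) ∞ M] where
  /-- the pseudohermitian structure `θ` -/
  form : ∀ x : M, TangentSpace (𝓡 (2 * n + 1)) x →L[ℝ] ℝ
  form_smooth : ContMDiff (𝓡 (2 * n + 1))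
    ((𝓡 (2 * n + 1)).prod 𝓘(ℝ, EuclideanSpace ℝ (Fin (2 * n + 1)) →L[ℝ] ℝ)) ∞
    (fun x => TotalSpace.mk' (EuclideanSpace ℝ (Fin (2 * n + 1)) →L[ℝ] ℝ)
      (E := fun x : M => TangentSpace (𝓡 (2 * n + 1)) x →L[ℝ] Bundle.Trivial M ℝ x)
      x (form x))
  form_ne_zero : ∀ x, form x ≠ 0
  /-- the complex structure along `H(M)`, extended to `T(M)` by `J T = 0` -/
  J : ∀ x : M, TangentSpace (𝓡 (2 * n + 1)) x →L[ℝ] TangentSpace (𝓡 (2 * n + 1)) x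
  J_smooth : ContMDiff (𝓡 (2 * n + 1))
    ((𝓡 (2 * n + 1)).prod 𝓘(ℝ, EuclideanSpace ℝ (Fin (2 * n + 1)) →L[ℝ]
      EuclideanSpace ℝ (Fin (2 * n + 1)))) ∞
    (fun x => TotalSpace.mk' (EuclideanSpace ℝ (Fin (2 * n + 1)) →L[ℝ]
        EuclideanSpace ℝ (Fin (2 * n + 1)))
      (E := fun x : M => TangentSpace (𝓡 (2 * n + 1)) x →L[ℝ] TangentSpace (𝓡 (2 * n + 1)) x)
      x (J x))
  J_mem : ∀ x v, form x v = 0 → form x (J x v) = 0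
  J_sq : ∀ x v, form x v = 0 → J x (J x v) = -v
  J_char : ∀ x, J x (charDirection form x) = 0
  /-- Formal integrability `[Γ(T_{1,0}), Γ(T_{1,0})] ⊆ Γ(T_{1,0})`: for horizontal `X`, `Y`,
  `[X - i J X, Y - i J Y] = ([X, Y] - [J X, J Y]) - i ([X, J Y] + [J X, Y])`
  is of the form `Z - i J Z` with `Z` horizontal. -/
  integrable : ∀ X Y : ∀ x : M, TangentSpace (𝓡 (2 * n + 1)) x,
    SmoothField X → SmoothField Y → (∀ x, form x (X x) = 0) → (∀ x, form x (Y x) = 0) →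
    ∀ x,
      form x (VectorField.mlieBracket (𝓡 (2 * n + 1)) X Y x
        - VectorField.mlieBracket (𝓡 (2 * n + 1)) (fun y => J y (X y)) (fun y => J y (Y y)) x)
        = 0 ∧
      J x (VectorField.mlieBracket (𝓡 (2 * n + 1)) X Y x
        - VectorField.mlieBracket (𝓡 (2 * n + 1)) (fun y => J y (X y)) (fun y => J y (Y y)) x)
        = VectorField.mlieBracket (𝓡 (2 * n + 1)) X (fun y => J y (Y y)) x
          + VectorField.mlieBracket (𝓡 (2 * n + 1)) (fun y => J y (X y)) Y x
  /-- strict pseudoconvexity: the Levi form `G_θ(X, Y) = (dθ)(X, J Y)` is positive definite -/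
  levi_pos : ∀ x v, form x v = 0 → v ≠ 0 → 0 < dForm form x v (J x v)

namespace PseudohermitianStructure

variable {n : ℕ} {M : Type*} [TopologicalSpace M]
  [ChartedSpace (EuclideanSpace ℝ (Fin (2 * n + 1))) M]
  [IsManifold (𝓡 (2 * n + 1)) ∞ M] (S : PseudohermitianStructure n M)

/-- The characteristic direction `T` of `(M, θ)`. -/
def T (x : M) : TangentSpace (𝓡 (2 * n + 1)) x := charDirection S.form x

/-- The Levi form `G_θ(v, w) = (dθ)(v, J w)` (used for horizontal `v`, `w`). -/
def levi (x : M) (v w : TangentSpace (𝓡 (2 * n + 1)) x) : ℝ := dForm S.form x v (S.J x w)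

/-- The length `|v| = G_θ(v, v)^{1/2}` of a horizontal vector. -/
def hNorm (x : M) (v : TangentSpace (𝓡 (2 * n + 1)) x) : ℝ := Real.sqrt (S.levi x v v)

/-- The projection `π_H : T(M) → H(M)` associated with `T(M) = H(M) ⊕ ℝ T`. -/
def projH (x : M) (v : TangentSpace (𝓡 (2 * n + 1)) x) : TangentSpace (𝓡 (2 * n + 1)) x :=
  v - S.form x v • S.T x

/-- The Webster metric: `G_θ` on `H(M)`, with `T` a unit vector orthogonal to `H(M)`. -/
def webster (x : M) (v w : TangentSpace (𝓡 (2 * n + 1)) x) : ℝ :=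
  S.levi x (S.projH x v) (S.projH x w) + S.form x v * S.form x w

/-! ### The Tanaka-Webster connection -/

/-- `∇` is the Tanaka-Webster connection of `(M, θ)`, the unique (smooth) linear connection such
that `H(M)` is parallel, `∇ g_θ = 0`, `∇ J = 0`, and the torsion is pure. In Mathlib's notation
`cov Y x (X x)` is `(∇_X Y)_x`. -/
structure IsTanakaWebster
    (cov : CovariantDerivative (𝓡 (2 * n + 1)) (EuclideanSpace ℝ (Fin (2 * n + 1)))
      (fun x : M => TangentSpace (𝓡 (2 * n + 1)) x)) : Prop where
  smooth : CovariantDerivative.ContMDiffCovariantDerivative cov ∞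
  parallel_H : ∀ Y : ∀ x : M, TangentSpace (𝓡 (2 * n + 1)) x,
    SmoothField Y → (∀ x, S.form x (Y x) = 0) → ∀ x v, S.form x (cov Y x v) = 0
  parallel_webster : ∀ Y Z : ∀ x : M, TangentSpace (𝓡 (2 * n + 1)) x,
    SmoothField Y → SmoothField Z → ∀ x v,
      mvfderiv (𝓡 (2 * n + 1)) (fun y => S.webster y (Y y) (Z y)) x v
        = S.webster x (cov Y x v) (Z x) + S.webster x (Y x) (cov Z x v)
  parallel_J : ∀ Y : ∀ x : M, TangentSpace (𝓡 (2 * n + 1)) x,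
    SmoothField Y → ∀ x v, cov (fun y => S.J y (Y y)) x v = S.J x (cov Y x v)
  /-- `T_∇(Z, W) = 0` for `Z = v - i J v`, `W = w - i J w` in `T_{1,0}(M)`: real and imaginary
  part. -/
  torsion_holo : ∀ x v w, S.form x v = 0 → S.form x w = 0 →
    cov.torsion x v w - cov.torsion x (S.J x v) (S.J x w) = 0 ∧
    cov.torsion x v (S.J x w) + cov.torsion x (S.J x v) w = 0
  /-- `T_∇(Z, W̄) = 2 i G_θ(Z, W̄) T` for `Z = v - i J v`, `W = w - i J w` in `T_{1,0}(M)`: real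
  and imaginary part (everything being extended complex bilinearly). -/
  torsion_mixed : ∀ x v w, S.form x v = 0 → S.form x w = 0 →
    cov.torsion x v w + cov.torsion x (S.J x v) (S.J x w)
      = (-2 * (S.levi x v (S.J x w) - S.levi x (S.J x v) w)) • S.T x ∧
    cov.torsion x v (S.J x w) - cov.torsion x (S.J x v) w
      = (2 * (S.levi x v w + S.levi x (S.J x v) (S.J x w))) • S.T x
  /-- `τ ∘ J + J ∘ τ = 0`, where `τ(X) = T_∇(T, X)` -/
  torsion_char : ∀ x v,
    cov.torsion x (S.T x) (S.J x v) + S.J x (cov.torsion x (S.T x) v) = 0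

/-- `(M, θ)` is a Sasakian manifold: the pseudohermitian torsion `τ(X) = T_∇(T, X)` of its
Tanaka-Webster connection `∇` vanishes. -/
def IsSasakian
    (cov : CovariantDerivative (𝓡 (2 * n + 1)) (EuclideanSpace ℝ (Fin (2 * n + 1)))
      (fun x : M => TangentSpace (𝓡 (2 * n + 1)) x)) : Prop :=
  ∀ x v, cov.torsion x (S.T x) v = 0

/-! ### Lengthy curves and the Carnot-Carathéodory distance -/

/-- `γ : [a, b] → M` is a piecewise `C^1` lengthy curve: it is continuous, `C^1` up to the end
points on the pieces of a finite partition, and `γ'(t) ∈ H(M)` wherever `γ'(t)` is defined. -/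
def IsLengthyCurve (γ : ℝ → M) (a b : ℝ) : Prop :=
  ContinuousOn γ (Icc a b) ∧
  (∃ P : Finset ℝ, ∀ c d : ℝ, a ≤ c → c < d → d ≤ b → (∀ p ∈ P, p ∉ Ioo c d) →
    ContMDiffOn 𝓘(ℝ, ℝ) (𝓡 (2 * n + 1)) 1 γ (Icc c d)) ∧
  ∀ t ∈ Ioo a b, MDifferentiableAt 𝓘(ℝ, ℝ) (𝓡 (2 * n + 1)) γ t →
    S.form (γ t) (velocity γ t) = 0

/-- The length `∫_a^b G_θ(γ', γ')^{1/2} dt` of a lengthy curve. -/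
def curveLength (γ : ℝ → M) (a b : ℝ) : ℝ≥0∞ :=
  ∫⁻ t in Ioo a b, ENNReal.ofReal (S.hNorm (γ t) (velocity γ t))

/-- The Carnot-Carathéodory distance: the infimum of the lengths of all lengthy curves joining
`x` and `y` (it is `∞` if there is none, which happens only in different components of `M`). -/
def ccDist (x y : M) : ℝ≥0∞ :=
  ⨅ (γ : ℝ → M) (a : ℝ) (b : ℝ) (_ : a ≤ b ∧ S.IsLengthyCurve γ a b ∧ γ a = x ∧ γ b = y),
    S.curveLength γ a b

/-- The Carnot-Carathéodory ball `B(x₀, R)`. -/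
def ccBall (x₀ : M) (R : ℝ) : Set M := {x | S.ccDist x₀ x < ENNReal.ofReal R}

/-- The horizontal disc `N(x₀, R) = {w ∈ H(M)_{x₀} : |w| < R}`. -/
def hDisc (x₀ : M) (R : ℝ) : Set (TangentSpace (𝓡 (2 * n + 1)) x₀) :=
  {w | S.form x₀ w = 0 ∧ S.hNorm x₀ w < R}

end PseudohermitianStructure

/-! ### Geodesics and the exponential map of a linear connection -/

section Geodesics

variable {n : ℕ} {M : Type*} [TopologicalSpace M]
  [ChartedSpace (EuclideanSpace ℝ (Fin (2 * n + 1))) M]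
  [IsManifold (𝓡 (2 * n + 1)) ∞ M]
  (cov : CovariantDerivative (𝓡 (2 * n + 1)) (EuclideanSpace ℝ (Fin (2 * n + 1)))
    (fun x : M => TangentSpace (𝓡 (2 * n + 1)) x))

/-- The covariant derivative `(∇_{γ'} V)(t)` of a vector field `V` along `γ`. In the trivialization
of `T(M)` at `γ(t)` one has `V(s) = ∑ Vⁱ(s) E_i`, with the frame `E_i` of constant coordinates, and
`∇_{γ'} V = ∑ (dVⁱ/ds) E_i + Vⁱ ∇_{γ'} E_i`; the second sum is `∇_{γ'}` applied to the local
extension of `V(t)` with constant coordinates. -/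
def covDerivAlong (γ : ℝ → M) (V : ∀ t : ℝ, TangentSpace (𝓡 (2 * n + 1)) (γ t)) (t : ℝ) :
    TangentSpace (𝓡 (2 * n + 1)) (γ t) :=
  let e := trivializationAt (EuclideanSpace ℝ (Fin (2 * n + 1)))
    (fun x : M => TangentSpace (𝓡 (2 * n + 1)) x) (γ t)
  e.symm (γ t)
      (deriv (fun s => (e (⟨γ s, V s⟩ : TangentBundle (𝓡 (2 * n + 1)) M)).2) t)
    + cov (FiberBundle.extend (EuclideanSpace ℝ (Fin (2 * n + 1))) (V t)) (γ t)
        (velocity γ t)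

/-- `γ` is a geodesic of `∇` on the open set `s` of parameters: `∇_{γ'} γ' = 0`. -/
def IsGeodesicOn (γ : ℝ → M) (s : Set ℝ) : Prop :=
  ContMDiffOn 𝓘(ℝ, ℝ) (𝓡 (2 * n + 1)) 2 γ s ∧
    ∀ t ∈ s, covDerivAlong cov γ (velocity γ) t = 0

/-- `γ : ℝ → M` is a geodesic of `∇` with `γ(0) = x` and `γ'(0) = w`. -/
def IsGeodesicFrom (x : M) (w : TangentSpace (𝓡 (2 * n + 1)) x) (γ : ℝ → M) : Prop :=
  IsGeodesicOn cov γ univ ∧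
    (⟨γ 0, velocity γ 0⟩ : TangentBundle (𝓡 (2 * n + 1)) M) = ⟨x, w⟩

open Classical in
/-- The exponential map of `∇` at `x`: `exp_x(w) = γ(1)`, where `γ : ℝ → M` is the geodesic with
`γ(0) = x` and `γ'(0) = w` (junk value `x` if there is no such geodesic). -/
def expMap (x : M) (w : TangentSpace (𝓡 (2 * n + 1)) x) : M :=
  if h : ∃ γ : ℝ → M, IsGeodesicFrom cov x w γ then h.choose 1 else x

/-- `γ : [a, b] → M` is a lengthy geodesic of `∇` joining `x` and `y` whose length is the
Carnot-Carathéodory distance of `x` and `y`. The geodesic is only required to be defined in some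
neighbourhood of `[a, b]`. -/
def IsMinimizingLengthyGeodesic (S : PseudohermitianStructure n M) (γ : ℝ → M) (a b : ℝ)
    (x y : M) : Prop :=
  a ≤ b ∧ (∃ s : Set ℝ, IsOpen s ∧ Icc a b ⊆ s ∧ IsGeodesicOn cov γ s) ∧
    (∀ t ∈ Icc a b, S.form (γ t) (velocity γ t) = 0) ∧
    γ a = x ∧ γ b = y ∧ S.curveLength γ a b = S.ccDist x y

end Geodesics

end

/-! The theorem is a Hopf-Rinow statement in which the minimizing geodesics are given, so what has
to be shown is that `∇` is complete and that its geodesics keep their speed and their horizontality.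

Two conservation laws carry everything. Since `∇g_θ = 0`, the Webster norm of the velocity of a
geodesic is constant (`IsTanakaWebster.hasDerivAt_webster_velocity`). Since `∇J = 0` and `T` has
unit length, `∇T = 0` (`IsTanakaWebster.cov_T`); as `θ = g_θ(·, T)`, also `∇θ = 0`, and `θ(γ')` is
constant (`IsTanakaWebster.hasDerivAt_form_velocity`). A geodesic that starts horizontally is
therefore lengthy, and its length is its initial speed times the elapsed time.

Completeness: in a chart the geodesic equation is a smooth first order system, so geodesics exist
for a time that is locally uniform over bounded initial velocities. Compactness of `M` makes that
time uniform, and the constant speed lets the extension be repeated forever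
(`IsTanakaWebster.existsUnique_isGeodesicFrom`).

For horizontal `w`, the geodesic on `[0, 1]` with initial velocity `w` is a lengthy curve of length
`|w|`, so `ρ(x₀, exp w) ≤ |w|`; this gives the inclusion. Conversely a minimizing lengthy geodesic
from `x₀` to `x`, reparametrized on `[0, 1]`, has an initial velocity of length `ρ(x₀, x)`; by
uniqueness of geodesics, `exp` sends that vector to `x`; this gives surjectivity. -/

noncomputable section

open Filter Topology


/-! ### Regularity of vector fields at a point. -/

section Fields

variable {n : ℕ} {M : Type*} [TopologicalSpace M]
  [ChartedSpace (EuclideanSpace ℝ (Fin (2 * n + 1))) M]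
  [IsManifold (𝓡 (2 * n + 1)) ∞ M]

/-- A (rough) vector field on `M`. -/
abbrev VField (n : ℕ) (M : Type*) [TopologicalSpace M]
    [ChartedSpace (EuclideanSpace ℝ (Fin (2 * n + 1))) M] :=
  ∀ x : M, TangentSpace (𝓡 (2 * n + 1)) x

/-- The vector field `X` is of class `C^k` at `x`. -/
abbrev ContMDiffFieldAt (k : ℕ∞ω) (X : VField n M) (x : M) : Prop :=
  ContMDiffAt (𝓡 (2 * n + 1)) (𝓡 (2 * n + 1)).tangent k
    (fun y => (⟨y, X y⟩ : TangentBundle (𝓡 (2 * n + 1)) M)) x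

/-- The vector field `X` is differentiable at `x`. -/
abbrev MDiffFieldAt (X : VField n M) (x : M) : Prop :=
  MDifferentiableAt (𝓡 (2 * n + 1)) (𝓡 (2 * n + 1)).tangent
    (fun y => (⟨y, X y⟩ : TangentBundle (𝓡 (2 * n + 1)) M)) x

lemma ContMDiffFieldAt.mdiff {k : ℕ∞ω} {X : VField n M} {x : M} (h : ContMDiffFieldAt k X x)
    (hk : k ≠ 0) : MDiffFieldAt X x := ContMDiffAt.mdifferentiableAt h hk

lemma mdiffFieldAt_extend {x : M} (v : TangentSpace (𝓡 (2 * n + 1)) x) :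
    MDiffFieldAt (FiberBundle.extend (EuclideanSpace ℝ (Fin (2 * n + 1))) v) x :=
  FiberBundle.mdifferentiableAt_extend (𝓡 (2 * n + 1)) _ v

end Fields

/-! ### The form `dθ` as a tensor, the characteristic direction and the Webster metric. -/

namespace PseudohermitianStructure
variable {n : ℕ} {M : Type*} [TopologicalSpace M]
  [ChartedSpace (EuclideanSpace ℝ (Fin (2 * n + 1))) M]
  [IsManifold (𝓡 (2 * n + 1)) ∞ M] (S : PseudohermitianStructure n M)

lemma contMDiffAt_form_apply {k : ℕ∞ω} (hk : k ≤ (∞ : ℕ∞ω)) {X : VField n M} {x : M}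
    (hX : ContMDiffFieldAt k X x) : ContMDiffAt (𝓡 (2 * n + 1)) 𝓘(ℝ, ℝ) k (fun y => S.form y (X y)) x := by
  have h := ContMDiffAt.clm_bundle_apply (E₂ := Bundle.Trivial M ℝ) (n := k)
    ((S.form_smooth x).of_le hk) hX
  rw [contMDiffAt_section] at h
  exact h

lemma contMDiffFieldAt_J {k : ℕ∞ω} (hk : k ≤ (∞ : ℕ∞ω)) {X : VField n M} {x : M}
    (hX : ContMDiffFieldAt k X x) : ContMDiffFieldAt k (fun y => S.J y (X y)) x := by
  exact ContMDiffAt.clm_bundle_apply (n := k) ((S.J_smooth x).of_le hk) hX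

lemma mdifferentiableAt_form_apply {X : VField n M} {x : M}
    (hX : MDiffFieldAt X x) : MDifferentiableAt (𝓡 (2 * n + 1)) 𝓘(ℝ, ℝ) (fun y => S.form y (X y)) x := by
  have h := MDifferentiableAt.clm_bundle_apply (E₂ := Bundle.Trivial M ℝ)
    ((S.form_smooth x).mdifferentiableAt (by simp)) hX
  rw [mdifferentiableAt_section] at h
  exact h

/-- `2 dθ(X, Y)` for vector fields `X`, `Y`, by the invariant formula. -/
def twoDForm (X Y : VField n M) (x : M) : ℝ :=
  mvfderiv (𝓡 (2 * n + 1)) (fun y => S.form y (Y y)) x (X x)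
    - mvfderiv (𝓡 (2 * n + 1)) (fun y => S.form y (X y)) x (Y x)
    - S.form x (VectorField.mlieBracket (𝓡 (2 * n + 1)) X Y x)

lemma twoDForm_swap (X Y : VField n M) (x : M) : S.twoDForm X Y x = - S.twoDForm Y X x := by
  simp only [twoDForm]
  rw [VectorField.mlieBracket_swap_apply, map_neg]
  ring

/-- The term `X(f) θ(Y)` produced by `X(θ(fY))` cancels against the one produced by `θ([X, fY])`. -/
lemma tensorial_twoDForm (X : VField n M) (x : M) :
    TensorialAt (𝓡 (2 * n + 1)) (EuclideanSpace ℝ (Fin (2 * n + 1))) (S.twoDForm X · x) x where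
  smul {f Y} hf hY := by
    have h : mvfderiv (𝓡 (2 * n + 1)) (fun y => S.form y ((f • Y) y)) x
        = f x • mvfderiv (𝓡 (2 * n + 1)) (fun y => S.form y (Y y)) x
          + S.form x (Y x) • mvfderiv (𝓡 (2 * n + 1)) f x := by
      have : (fun y => S.form y ((f • Y) y)) = f * fun y => S.form y (Y y) := by
        ext y; simp
      rw [this, mvfderiv_mul hf (S.mdifferentiableAt_form_apply hY)]
    simp only [twoDForm]
    rw [h, VectorField.mlieBracket_smul_right hf hY]
    simp
    ring
  add {Y Y'} hY hY' := by
    have h : mvfderiv (𝓡 (2 * n + 1)) (fun y => S.form y ((Y + Y') y)) x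
        = mvfderiv (𝓡 (2 * n + 1)) (fun y => S.form y (Y y)) x
          + mvfderiv (𝓡 (2 * n + 1)) (fun y => S.form y (Y' y)) x := by
      rw [← mvfderiv_add (S.mdifferentiableAt_form_apply hY) (S.mdifferentiableAt_form_apply hY')]
      congr 1; ext y; simp
    simp only [twoDForm]
    rw [h, VectorField.mlieBracket_add_right hY hY']
    simp
    ring

lemma tensorial_twoDForm_left (Y : VField n M) (x : M) :
    TensorialAt (𝓡 (2 * n + 1)) (EuclideanSpace ℝ (Fin (2 * n + 1))) (S.twoDForm · Y x) x where
  smul hf hX := by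
    simp only [S.twoDForm_swap _ Y, (S.tensorial_twoDForm Y x).smul hf hX, smul_neg]
  add hX hX' := by
    simp only [S.twoDForm_swap _ Y, (S.tensorial_twoDForm Y x).add hX hX', neg_add]

/-- The exterior derivative `dθ` at `x` as a bilinear form. -/
def dFormL (x : M) : TangentSpace (𝓡 (2 * n + 1)) x →L[ℝ] TangentSpace (𝓡 (2 * n + 1)) x →L[ℝ] ℝ :=
  (1 / 2 : ℝ) • TensorialAt.mkHom₂ (S.twoDForm · · x) x
    (fun Y _ => S.tensorial_twoDForm_left Y x) (fun X _ => S.tensorial_twoDForm X x)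

lemma dForm_eq_dFormL (x : M) (v w : TangentSpace (𝓡 (2 * n + 1)) x) :
    dForm S.form x v w = S.dFormL x v w := by
  simp [dFormL, TensorialAt.mkHom₂_apply_eq_extend, dForm, twoDForm]

/-- By tensoriality the pointwise extensions used in `dForm` can be replaced by given fields; this
is what makes `dθ(X, Y)` accessible as a function of the point. -/
lemma dForm_apply {X Y : VField n M} {x : M} (hX : MDiffFieldAt X x) (hY : MDiffFieldAt Y x) :
    dForm S.form x (X x) (Y x) = (1 / 2) * S.twoDForm X Y x := by
  rw [dForm_eq_dFormL, dFormL]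
  simp only [smul_apply, smul_eq_mul]
  rw [TensorialAt.mkHom₂_apply _ _ hX hY]

lemma dForm_swap (x : M) (v w : TangentSpace (𝓡 (2 * n + 1)) x) :
    dForm S.form x v w = - dForm S.form x w v := by
  have := S.dForm_apply (mdiffFieldAt_extend v) (mdiffFieldAt_extend w)
  have h' := S.dForm_apply (mdiffFieldAt_extend w) (mdiffFieldAt_extend v)
  simp only [FiberBundle.extend_apply_self] at this h'
  rw [this, h', twoDForm_swap]; ring

/-- Positivity of the Levi form makes `dθ` nondegenerate on `H = Ker θ`. For any `z` with `θ(z) =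
1`, the functional `dθ(z, ·)` on `H` is then `dθ(h, ·)` for some `h ∈ H`, and `z - h` is the
required vector. This justifies the choice in `charDirection`. -/
lemma exists_charDirection (x : M) : ∃ v, S.form x v = 1 ∧ ∀ w, dForm S.form x v w = 0 := by
  obtain ⟨z, hz⟩ : ∃ z, S.form x z = 1 := by
    obtain ⟨u, hu⟩ : ∃ u, S.form x u ≠ 0 := by
      by_contra! h
      exact S.form_ne_zero x (ContinuousLinearMap.ext h)
    exact ⟨(S.form x u)⁻¹ • u, by simp [hu]⟩
  let _ : FiniteDimensional ℝ (TangentSpace (𝓡 (2 * n + 1)) x) :=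
    inferInstanceAs (FiniteDimensional ℝ (EuclideanSpace ℝ (Fin (2 * n + 1))))
  let H : Submodule ℝ (TangentSpace (𝓡 (2 * n + 1)) x) := LinearMap.ker (S.form x).toLinearMap
  let B : H →ₗ[ℝ] Module.Dual ℝ H :=
    LinearMap.mk₂ ℝ (fun u w => S.dFormL x u w) (by simp) (by simp) (by simp) (by simp)
  have : IsManifold (𝓡 (2 * n + 1)) (minSmoothness ℝ 2) M := by
    rw [minSmoothness_of_isRCLikeNormedField]; infer_instance
  have : IsManifold (𝓡 (2 * n + 1)) (((⊤ : ℕ∞) : ℕ∞ω) + 1) M := ‹IsManifold (𝓡 (2 * n + 1)) ∞ M›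
  have hB : Function.Injective B := by
    rw [injective_iff_map_eq_zero]
    intro u hu
    by_contra hne
    have hu0 : S.form x u = 0 := u.2
    have := S.levi_pos x u hu0 (by simpa using hne)
    rw [dForm_eq_dFormL] at this
    -- Testing against `Ju` turns a vector in the kernel into one with vanishing Levi form.
    have h2 := LinearMap.congr_fun hu ⟨S.J x u, S.J_mem x u hu0⟩
    simp only [B, LinearMap.mk₂_apply, LinearMap.zero_apply] at h2
    linarith
  obtain ⟨h, hh⟩ := (LinearMap.injective_iff_surjective_of_finrank_eq_finrank
    (Subspace.dual_finrank_eq (K := ℝ) (V := H)).symm).1 hB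
    ((S.dFormL x z).toLinearMap ∘ₗ H.subtype)
  have hh' : ∀ w, S.form x w = 0 → S.dFormL x h w = S.dFormL x z w := fun w hw =>
    LinearMap.congr_fun hh ⟨w, hw⟩
  have hh0 : S.form x h = 0 := h.2
  have h1 : S.form x (z - h) = 1 := by simp [hz, hh0]
  refine ⟨z - h, h1, fun w => ?_⟩
  rw [dForm_eq_dFormL]
  have hself : S.dFormL x (z - h) (z - h) = 0 := by
    have := S.dForm_swap x (z - h) (z - h)
    rw [dForm_eq_dFormL] at this
    linarith
  have hw : w = (w - S.form x w • (z - h)) + S.form x w • (z - h) := by abel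
  have hw0 : S.form x (w - S.form x w • (z - h)) = 0 := by simp [hz, hh0]
  rw [hw, map_add, map_smul, hself, smul_zero, add_zero, map_sub (S.dFormL x), sub_apply,
    hh' _ hw0, sub_self]

lemma form_T (x : M) : S.form x (S.T x) = 1 :=
  (Classical.epsilon_spec (S.exists_charDirection x)).1

lemma dForm_T (x : M) (w : TangentSpace (𝓡 (2 * n + 1)) x) : dForm S.form x (S.T x) w = 0 :=
  (Classical.epsilon_spec (S.exists_charDirection x)).2 w

lemma J_T (x : M) : S.J x (S.T x) = 0 := S.J_char x

/-- Extends `J² = -1` from `H(M)` to all of `T(M)` by projecting along `T`, which `J` kills. -/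
lemma J_J (x : M) (v : TangentSpace (𝓡 (2 * n + 1)) x) :
    S.J x (S.J x v) = S.form x v • S.T x - v := by
  have h := S.J_sq x (v - S.form x v • S.T x) (by simp [form_T])
  simp only [map_sub, map_smul, J_T, smul_zero, sub_zero, neg_sub] at h
  exact h

/-- The Webster metric at `x` as a bilinear form. -/
lemma webster_eq (x : M) (v w : TangentSpace (𝓡 (2 * n + 1)) x) :
    S.webster x v w = S.dFormL x v (S.J x w) + S.form x v * S.form x w := by
  have hT : ∀ w, S.dFormL x (S.T x) w = 0 := fun w => by
    rw [← dForm_eq_dFormL, dForm_T]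
  simp [webster, levi, projH, dForm_eq_dFormL, J_T, hT]

/-- Through this duality, statements on `θ` follow from statements on the metric and `T`. -/
lemma webster_T (x : M) (v : TangentSpace (𝓡 (2 * n + 1)) x) :
    S.webster x v (S.T x) = S.form x v := by
  simp [webster_eq, J_T, form_T]

lemma webster_self_of_form_eq_zero {x : M} {v : TangentSpace (𝓡 (2 * n + 1)) x}
    (hv : S.form x v = 0) : S.webster x v v = S.levi x v v := by
  simp [webster, projH, hv]

lemma webster_pos (x : M) {v : TangentSpace (𝓡 (2 * n + 1)) x} (hv : v ≠ 0) :
    0 < S.webster x v v := by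
  have h0 : S.form x (S.projH x v) = 0 := by simp [projH, form_T]
  by_cases h : S.projH x v = 0
  · have hf : S.form x v ≠ 0 := by
      intro hf
      apply hv
      simpa [projH, hf] using h
    simp only [webster, levi, h, dForm_eq_dFormL]
    simpa using mul_self_pos.2 hf
  · have := S.levi_pos x _ h0 h
    simp only [webster, levi]
    nlinarith [mul_self_nonneg (S.form x v)]

lemma contMDiffAt_mvfderiv_apply {f : M → ℝ} {X : VField n M} {x : M}
    (hf : ContMDiffAt (𝓡 (2 * n + 1)) 𝓘(ℝ, ℝ) ∞ f x) (hX : ContMDiffFieldAt ∞ X x) :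
    ContMDiffAt (𝓡 (2 * n + 1)) 𝓘(ℝ, ℝ) ∞ (fun y => mvfderiv (𝓡 (2 * n + 1)) f y (X y)) x := by
  have h1 := ContMDiffAt.mfderiv_const hf (m := ∞) (by simp)
  have h2 := ContMDiffAt.clm_apply_of_inCoordinates (F₂ := ℝ) (E₂ := TangentSpace 𝓘(ℝ, ℝ)) h1 hX hf
  rw [contMDiffAt_totalSpace] at h2
  simpa [mvfderiv] using! h2.2

lemma contMDiffAt_twoDForm {X Y : VField n M} {x : M} (hX : ContMDiffFieldAt ∞ X x)
    (hY : ContMDiffFieldAt ∞ Y x) :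
    ContMDiffAt (𝓡 (2 * n + 1)) 𝓘(ℝ, ℝ) ∞ (S.twoDForm X Y) x := by
  have : IsManifold (𝓡 (2 * n + 1)) (minSmoothness ℝ 2) M := by
    rw [minSmoothness_of_isRCLikeNormedField]; infer_instance
  have : IsManifold (𝓡 (2 * n + 1)) (((⊤ : ℕ∞) : ℕ∞ω) + 1) M := ‹IsManifold (𝓡 (2 * n + 1)) ∞ M›
  have hB : ContMDiffFieldAt ∞ (VectorField.mlieBracket (𝓡 (2 * n + 1)) X Y) x :=
    ContMDiffAt.mlieBracket_vectorField (m := ⊤) (n := ⊤) hX hY (by simp)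
  refine ContMDiffAt.sub (ContMDiffAt.sub ?_ ?_) ?_
  · exact contMDiffAt_mvfderiv_apply (S.contMDiffAt_form_apply le_rfl hY) hX
  · exact contMDiffAt_mvfderiv_apply (S.contMDiffAt_form_apply le_rfl hX) hY
  · exact S.contMDiffAt_form_apply le_rfl hB
end PseudohermitianStructure


/-! ### Constant-coordinate fields, and passage from local to global fields. -/

section Fields

variable {n : ℕ} {M : Type*} [TopologicalSpace M]
  [ChartedSpace (EuclideanSpace ℝ (Fin (2 * n + 1))) M]
  [IsManifold (𝓡 (2 * n + 1)) ∞ M]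

lemma ContMDiffFieldAt.eventually_mdiff {X : VField n M} {x : M} (h : ContMDiffFieldAt ∞ X x) :
    ∀ᶠ y in 𝓝 x, MDiffFieldAt X y := by
  have h1 : ContMDiffFieldAt 1 X x := ContMDiffAt.of_le h (by simp)
  filter_upwards [(contMDiffAt_iff_contMDiffAt_nhds (by simp)).1 h1] with y hy
    using ContMDiffAt.mdifferentiableAt hy (by simp)

/-- The coordinates, in the trivialization of `T(M)` at `p`, of a tangent vector at `y`. -/
def tangentCoord (p y : M) : TangentSpace (𝓡 (2 * n + 1)) y →L[ℝ] EuclideanSpace ℝ (Fin (2 * n + 1)) :=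
  (trivializationAt (EuclideanSpace ℝ (Fin (2 * n + 1))) (TangentSpace (𝓡 (2 * n + 1))) p).continuousLinearMapAt ℝ y

/-- The tangent vector at `y` with given coordinates in the trivialization of `T(M)` at `p`. -/
def tangentCoordSymm (p y : M) : EuclideanSpace ℝ (Fin (2 * n + 1)) →L[ℝ] TangentSpace (𝓡 (2 * n + 1)) y :=
  (trivializationAt (EuclideanSpace ℝ (Fin (2 * n + 1))) (TangentSpace (𝓡 (2 * n + 1))) p).symmL ℝ y

lemma trivializationAt_snd {p q : M} (hq : q ∈ (chartAt (EuclideanSpace ℝ (Fin (2 * n + 1))) p).source)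
    (v : TangentSpace (𝓡 (2 * n + 1)) q) :
    (trivializationAt (EuclideanSpace ℝ (Fin (2 * n + 1))) (TangentSpace (𝓡 (2 * n + 1))) p
      (⟨q, v⟩ : TangentBundle (𝓡 (2 * n + 1)) M)).2 = tangentCoord p q v :=
  ((trivializationAt (EuclideanSpace ℝ (Fin (2 * n + 1)))
    (TangentSpace (𝓡 (2 * n + 1)) : M → Type _) p).continuousLinearMapAt_apply_of_mem ℝ hq v).symm

lemma tangentCoord_symm {p q : M} (hq : q ∈ (chartAt (EuclideanSpace ℝ (Fin (2 * n + 1))) p).source)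
    (u : EuclideanSpace ℝ (Fin (2 * n + 1))) : tangentCoord p q (tangentCoordSymm p q u) = u :=
  (trivializationAt (EuclideanSpace ℝ (Fin (2 * n + 1)))
    (TangentSpace (𝓡 (2 * n + 1)) : M → Type _) p).continuousLinearMapAt_symmL (R := ℝ) hq u

lemma tangentCoordSymm_coord {p q : M} (hq : q ∈ (chartAt (EuclideanSpace ℝ (Fin (2 * n + 1))) p).source)
    (v : TangentSpace (𝓡 (2 * n + 1)) q) : tangentCoordSymm p q (tangentCoord p q v) = v :=
  (trivializationAt (EuclideanSpace ℝ (Fin (2 * n + 1)))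
    (TangentSpace (𝓡 (2 * n + 1)) : M → Type _) p).symmL_continuousLinearMapAt (R := ℝ) hq v

/-- The vector field with constant coordinates `u` in the trivialization of `T(M)` at `p`. -/
def coordField (p : M) (u : EuclideanSpace ℝ (Fin (2 * n + 1))) : VField n M := fun y =>
  tangentCoordSymm p y u

lemma contMDiffFieldAt_coordField {p y : M} (hy : y ∈ (chartAt (EuclideanSpace ℝ (Fin (2 * n + 1))) p).source)
    (u : EuclideanSpace ℝ (Fin (2 * n + 1))) : ContMDiffFieldAt ∞ (coordField p u) y := by
  set e := trivializationAt (EuclideanSpace ℝ (Fin (2 * n + 1))) (TangentSpace (𝓡 (2 * n + 1)) : M → Type _) p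
  have : ContMDiffOn (𝓡 (2 * n + 1)) (𝓡 (2 * n + 1)).tangent ∞
    (fun y => (⟨y, coordField p u y⟩ : TangentBundle (𝓡 (2 * n + 1)) M)) e.baseSet := by
    refine (e.contMDiffOn_section_baseSet_iff).2 ?_
    refine (contMDiffOn_const (c := u)).congr fun z hz => ?_
    exact (trivializationAt_snd hz _).trans (tangentCoord_symm hz u)
  exact this.contMDiffAt (e.open_baseSet.mem_nhds hy)

lemma eventually_contMDiffFieldAt_coordField {p y : M}
    (hy : y ∈ (chartAt (EuclideanSpace ℝ (Fin (2 * n + 1))) p).source)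
    (u : EuclideanSpace ℝ (Fin (2 * n + 1))) : ∀ᶠ z in 𝓝 y, ContMDiffFieldAt ∞ (coordField p u) z := by
  filter_upwards [(chartAt _ p).open_source.mem_nhds hy] with z hz
    using contMDiffFieldAt_coordField hz u

/-- A vector field which is smooth near `x` coincides near `x` with a globally smooth one. -/
lemma exists_smoothField_eventuallyEq [T2Space M] {X : VField n M} {x : M}
    (hX : ∀ᶠ y in 𝓝 x, ContMDiffFieldAt ∞ X y) :
    ∃ X' : VField n M, SmoothField X' ∧ ∀ᶠ y in 𝓝 x, X' y = X y := by
  obtain ⟨U, hU, hUo, hxU⟩ := eventually_nhds_iff.1 hX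
  obtain ⟨f, -, hf⟩ := (SmoothBumpFunction.nhds_basis_tsupport (I := 𝓡 (2 * n + 1)) x).mem_iff.1
    (hUo.mem_nhds hxU)
  refine ⟨(f : M → ℝ) • X, ?_, ?_⟩
  · exact ContMDiffOn.smul_section_of_tsupport f.contMDiff.contMDiffOn hUo hf
      fun y hy => (hU y hy).contMDiffWithinAt
  · filter_upwards [f.eventuallyEq_one] with y hy
    simp [hy]

/-- The axioms in `IsTanakaWebster` concern global smooth fields; locality of `∇` together with
`exists_smoothField_eventuallyEq` carries them over to local frames. -/
lemma CovariantDerivative.congr_of_eventuallyEq_field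
    (cov : CovariantDerivative (𝓡 (2 * n + 1)) (EuclideanSpace ℝ (Fin (2 * n + 1)))
      (fun x : M => TangentSpace (𝓡 (2 * n + 1)) x)) {X Y : VField n M} {x : M}
    (hX : MDiffFieldAt X x) (h : ∀ᶠ y in 𝓝 x, Y y = X y) : cov Y x = cov X x := by
  refine cov.isCovariantDerivativeOnUniv.congr_of_eventuallyEq ?_ hX univ_mem h
  exact hX.congr_of_eventuallyEq (h.mono fun y hy => by simp [hy])

end Fields

/-! ### Smoothness of the metric and of `T`; parallelism of `T` and `θ`. -/

namespace PseudohermitianStructure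
variable {n : ℕ} {M : Type*} [TopologicalSpace M]
  [ChartedSpace (EuclideanSpace ℝ (Fin (2 * n + 1))) M]
  [IsManifold (𝓡 (2 * n + 1)) ∞ M] (S : PseudohermitianStructure n M)

lemma contMDiffAt_dForm {X Y : VField n M} {x : M} (hX : ContMDiffFieldAt ∞ X x)
    (hY : ContMDiffFieldAt ∞ Y x) :
    ContMDiffAt (𝓡 (2 * n + 1)) 𝓘(ℝ, ℝ) ∞ (fun y => dForm S.form y (X y) (Y y)) x := by
  have h : ContMDiffAt (𝓡 (2 * n + 1)) 𝓘(ℝ, ℝ) ∞ (fun y => (1 / 2 : ℝ) * S.twoDForm X Y y) x :=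
    contMDiffAt_const.mul (S.contMDiffAt_twoDForm hX hY)
  refine h.congr_of_eventuallyEq ?_
  filter_upwards [hX.eventually_mdiff, hY.eventually_mdiff] with y h1 h2 using S.dForm_apply h1 h2

lemma contMDiffAt_webster {X Y : VField n M} {x : M} (hX : ContMDiffFieldAt ∞ X x)
    (hY : ContMDiffFieldAt ∞ Y x) :
    ContMDiffAt (𝓡 (2 * n + 1)) 𝓘(ℝ, ℝ) ∞ (fun y => S.webster y (X y) (Y y)) x := by
  simp only [webster_eq, ← dForm_eq_dFormL]
  exact (S.contMDiffAt_dForm hX (S.contMDiffFieldAt_J le_rfl hY)).add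
    ((S.contMDiffAt_form_apply le_rfl hX).mul (S.contMDiffAt_form_apply le_rfl hY))

/-- By `J_J`, `X + J²X = θ(X) T`, so near `x` the field `T` is a smooth expression in any smooth `X`
with `θ(X) ≠ 0`. -/
lemma smoothField_T : SmoothField S.T := by
  intro x
  let X : VField n M := FiberBundle.extend (EuclideanSpace ℝ (Fin (2 * n + 1))) (S.T x)
  have hX : ContMDiffFieldAt ∞ X x := FiberBundle.contMDiffAt_extend (𝓡 (2 * n + 1)) _ _
  have hθ := S.contMDiffAt_form_apply le_rfl hX
  have hx : S.form x (X x) = 1 := by simp [X, form_T]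
  have hsm : ContMDiffFieldAt ∞ ((fun y => (S.form y (X y))⁻¹) • (X + fun y => S.J y (S.J y (X y)))) x :=
    ContMDiffAt.smul_section (hθ.inv₀ (by simp [hx]))
      (hX.add_section (S.contMDiffFieldAt_J le_rfl (S.contMDiffFieldAt_J le_rfl hX)))
  refine hsm.congr_of_eventuallyEq ?_
  have : ∀ᶠ y in 𝓝 x, S.form y (X y) ≠ 0 := hθ.continuousAt.eventually_ne (by simp [hx])
  filter_upwards [this] with y hy
  simp [J_J, smul_smul, hy]

variable {S}
variable {cov : CovariantDerivative (𝓡 (2 * n + 1)) (EuclideanSpace ℝ (Fin (2 * n + 1)))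
      (fun x : M => TangentSpace (𝓡 (2 * n + 1)) x)}

/-- Differentiating `JT = 0` gives `J(∇T) = 0`, so `∇T` is a multiple of `T`; differentiating
`g_θ(T, T) = 1` shows that the multiple is zero. -/
lemma IsTanakaWebster.cov_T (h : S.IsTanakaWebster cov) (x : M)
    (v : TangentSpace (𝓡 (2 * n + 1)) x) : cov S.T x v = 0 := by
  have hJ := h.parallel_J S.T S.smoothField_T x v
  have h0 : (fun y => S.J y (S.T y)) = 0 := by ext1 y; exact S.J_T y
  rw [h0, cov.zero] at hJ
  have h1 : cov S.T x v = S.form x (cov S.T x v) • S.T x := by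
    have := S.J_J x (cov S.T x v)
    rw [← hJ] at this
    simpa using (sub_eq_zero.1 (by simpa using this.symm)).symm
  have hg := h.parallel_webster S.T S.T S.smoothField_T S.smoothField_T x v
  have hc : (fun y => S.webster y (S.T y) (S.T y)) = fun _ => 1 := by
    ext y; rw [webster_T, form_T]
  rw [hc, mvfderiv_const, webster_T, h1] at hg
  have h2 : S.form x (cov S.T x v) = 0 := by
    simp [webster_eq, J_T, form_T, ← dForm_eq_dFormL, dForm_T] at hg
    linarith
  rw [h1, h2, zero_smul]

variable [T2Space M]

lemma IsTanakaWebster.mvfderiv_webster (h : S.IsTanakaWebster cov) {X Y : VField n M} {x : M}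
    (hX : ∀ᶠ y in 𝓝 x, ContMDiffFieldAt ∞ X y) (hY : ∀ᶠ y in 𝓝 x, ContMDiffFieldAt ∞ Y y)
    (v : TangentSpace (𝓡 (2 * n + 1)) x) :
    mvfderiv (𝓡 (2 * n + 1)) (fun y => S.webster y (X y) (Y y)) x v
      = S.webster x (cov X x v) (Y x) + S.webster x (X x) (cov Y x v) := by
  obtain ⟨X', hX', hXX'⟩ := exists_smoothField_eventuallyEq hX
  obtain ⟨Y', hY', hYY'⟩ := exists_smoothField_eventuallyEq hY
  have key := h.parallel_webster X' Y' hX' hY' x v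
  rw [cov.congr_of_eventuallyEq_field (hX.self_of_nhds.mdiff (by simp)) hXX',
    cov.congr_of_eventuallyEq_field (hY.self_of_nhds.mdiff (by simp)) hYY', hXX'.self_of_nhds,
    hYY'.self_of_nhds] at key
  rw [← key]
  have : (fun y => S.webster y (X y) (Y y)) =ᶠ[𝓝 x] fun y => S.webster y (X' y) (Y' y) := by
    filter_upwards [hXX', hYY'] with y h1 h2
    rw [h1, h2]
  simp only [mvfderiv, ContinuousLinearMap.comp_apply]
  rw [this.mfderiv_eq]
  rfl

/-- This is `∇θ = 0`, obtained from `θ = g_θ(·, T)` and `∇T = 0`. -/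
lemma IsTanakaWebster.mvfderiv_form (h : S.IsTanakaWebster cov) {X : VField n M} {x : M}
    (hX : ∀ᶠ y in 𝓝 x, ContMDiffFieldAt ∞ X y) (v : TangentSpace (𝓡 (2 * n + 1)) x) :
    mvfderiv (𝓡 (2 * n + 1)) (fun y => S.form y (X y)) x v = S.form x (cov X x v) := by
  have key := h.mvfderiv_webster hX (Eventually.of_forall fun y => S.smoothField_T y) v
  simp only [webster_T, h.cov_T] at key
  rw [key]
  simp [webster_eq]

end PseudohermitianStructure


/-! ### Chain rules for functions on the manifold and along curves. -/

section Calculus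

variable {n : ℕ} {M : Type*} [TopologicalSpace M]
  [ChartedSpace (EuclideanSpace ℝ (Fin (2 * n + 1))) M]
  {F F' : Type*} [NormedAddCommGroup F] [NormedSpace ℝ F] [NormedAddCommGroup F'] [NormedSpace ℝ F']

lemma mvfderiv_apply_congr {f g : M → F} {x : M} (h : f =ᶠ[𝓝 x] g)
    (v : TangentSpace (𝓡 (2 * n + 1)) x) :
    mvfderiv (𝓡 (2 * n + 1)) f x v = mvfderiv (𝓡 (2 * n + 1)) g x v := by
  simp only [mvfderiv, ContinuousLinearMap.comp_apply]
  rw [h.mfderiv_eq]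
  rfl

lemma mvfderiv_clm_comp (L : F →L[ℝ] F') {f : M → F} {x : M}
    (hf : MDifferentiableAt (𝓡 (2 * n + 1)) 𝓘(ℝ, F) f x) (v : TangentSpace (𝓡 (2 * n + 1)) x) :
    mvfderiv (𝓡 (2 * n + 1)) (fun y => L (f y)) x v = L (mvfderiv (𝓡 (2 * n + 1)) f x v) := by
  have h := (L.hasMFDerivAt.comp x hf.hasMFDerivAt).mfderiv
  simp only [mvfderiv, ContinuousLinearMap.comp_apply]
  erw [h]
  rfl

lemma hasDerivAt_comp_velocity {g : M → F} {γ : ℝ → M} {t : ℝ}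
    (hg : MDifferentiableAt (𝓡 (2 * n + 1)) 𝓘(ℝ, F) g (γ t))
    (hγ : MDifferentiableAt 𝓘(ℝ, ℝ) (𝓡 (2 * n + 1)) γ t) :
    HasDerivAt (fun s => g (γ s)) (mvfderiv (𝓡 (2 * n + 1)) g (γ t) (velocity γ t)) t := by
  have h1 := hg.hasMFDerivAt.comp t hγ.hasMFDerivAt
  let L : ℝ →L[ℝ] F := (mfderiv (𝓡 (2 * n + 1)) 𝓘(ℝ, F) g (γ t)).comp
    (mfderiv 𝓘(ℝ, ℝ) (𝓡 (2 * n + 1)) γ t)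
  have h2 : HasFDerivAt (g ∘ γ) L t := hasMFDerivAt_iff_hasFDerivAt.1 h1
  exact h2.hasDerivAt

end Calculus

/-! ### The connection in coordinates. -/

section Coordinates

variable {n : ℕ} {M : Type*} [TopologicalSpace M]
  [ChartedSpace (EuclideanSpace ℝ (Fin (2 * n + 1))) M]
  [IsManifold (𝓡 (2 * n + 1)) ∞ M]

variable {p q : M}

lemma mdifferentiableAt_tangentCoord {X : VField n M} (hX : MDiffFieldAt X q)
    (hq : q ∈ (chartAt (EuclideanSpace ℝ (Fin (2 * n + 1))) p).source) :
    MDifferentiableAt (𝓡 (2 * n + 1)) 𝓘(ℝ, EuclideanSpace ℝ (Fin (2 * n + 1)))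
      (fun y => tangentCoord p y (X y)) q := by
  have h := ((trivializationAt (EuclideanSpace ℝ (Fin (2 * n + 1)))
    (TangentSpace (𝓡 (2 * n + 1)) : M → Type _) p).mdifferentiableAt_section_iff (𝓡 (2 * n + 1)) X hq).1 hX
  refine h.congr_of_eventuallyEq ?_
  filter_upwards [(chartAt _ p).open_source.mem_nhds hq] with y hy
  exact (trivializationAt_snd hy _).symm

/-- A covariant derivative in terms of the coordinates of the vector field. -/
lemma CovariantDerivative.apply_eq_coord
    (cov : CovariantDerivative (𝓡 (2 * n + 1)) (EuclideanSpace ℝ (Fin (2 * n + 1)))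
      (fun x : M => TangentSpace (𝓡 (2 * n + 1)) x)) {X : VField n M} (hX : MDiffFieldAt X q)
    (hq : q ∈ (chartAt (EuclideanSpace ℝ (Fin (2 * n + 1))) p).source)
    (w : TangentSpace (𝓡 (2 * n + 1)) q) :
    cov X q w = tangentCoordSymm p q
        (mvfderiv (𝓡 (2 * n + 1)) (fun y => tangentCoord p y (X y)) q w)
      + cov (coordField p (tangentCoord p q (X q))) q w := by
  -- The Leibniz terms of `∇` and of the coordinate derivative cancel, so the difference `Φ` depends
  -- only on the value at `q`; it is then evaluated on the field with constant coordinates.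
  let Φ : VField n M → TangentSpace (𝓡 (2 * n + 1)) q := fun Y =>
    cov Y q w - tangentCoordSymm p q
        (mvfderiv (𝓡 (2 * n + 1)) (fun y => tangentCoord p y (Y y)) q w)
  have hΦ : TensorialAt (𝓡 (2 * n + 1)) (EuclideanSpace ℝ (Fin (2 * n + 1))) Φ q := by
    constructor
    · intro f Y hf hY
      have h : mvfderiv (𝓡 (2 * n + 1)) (fun y => tangentCoord p y ((f • Y) y)) q w
          = f q • mvfderiv (𝓡 (2 * n + 1)) (fun y => tangentCoord p y (Y y)) q w
            + mvfderiv (𝓡 (2 * n + 1)) f q w • tangentCoord p q (Y q) := by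
        have : (fun y => tangentCoord p y ((f • Y) y)) = f • fun y => tangentCoord p y (Y y) := by
          ext1 y; simp
        rw [this, mvfderiv_smul hf (mdifferentiableAt_tangentCoord hY hq)]
        simp
      simp only [Φ]
      rw [h, cov.isCovariantDerivativeOnUniv.leibniz hY hf]
      simp [tangentCoordSymm_coord hq]
      module
    · intro Y Y' hY hY'
      have h : mvfderiv (𝓡 (2 * n + 1)) (fun y => tangentCoord p y ((Y + Y') y)) q w
          = mvfderiv (𝓡 (2 * n + 1)) (fun y => tangentCoord p y (Y y)) q w
            + mvfderiv (𝓡 (2 * n + 1)) (fun y => tangentCoord p y (Y' y)) q w := by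
        have : (fun y => tangentCoord p y ((Y + Y') y))
            = (fun y => tangentCoord p y (Y y)) + fun y => tangentCoord p y (Y' y) := by
          ext1 y; simp
        rw [this, mvfderiv_add (mdifferentiableAt_tangentCoord hY hq) (mdifferentiableAt_tangentCoord hY' hq)]
        simp
      simp only [Φ]
      rw [h, cov.isCovariantDerivativeOnUniv.add hY hY']
      simp
      module
  have hC := contMDiffFieldAt_coordField hq (tangentCoord p q (X q))
  have h := hΦ.pointwise hX (hC.mdiff (by simp))
    (by exact (tangentCoordSymm_coord hq _).symm)
  have h0 : mvfderiv (𝓡 (2 * n + 1))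
      (fun y => tangentCoord p y (coordField p (tangentCoord p q (X q)) y)) q w = 0 := by
    have : (fun y => tangentCoord p y (coordField p (tangentCoord p q (X q)) y))
        =ᶠ[𝓝 q] fun _ => tangentCoord p q (X q) := by
      filter_upwards [(chartAt _ p).open_source.mem_nhds hq] with y hy
      exact tangentCoord_symm hy _
    rw [mvfderiv_apply_congr this, mvfderiv_const]
    rfl
  simp only [Φ, h0, map_zero, sub_zero] at h
  rw [← h]; abel

/-- The Christoffel symbol of `∇` in the chart at `p`. -/
def christoffel (cov : CovariantDerivative (𝓡 (2 * n + 1)) (EuclideanSpace ℝ (Fin (2 * n + 1)))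
      (fun x : M => TangentSpace (𝓡 (2 * n + 1)) x)) (p y : M)
    (u w : EuclideanSpace ℝ (Fin (2 * n + 1))) : EuclideanSpace ℝ (Fin (2 * n + 1)) :=
  tangentCoord p y (cov (coordField p u) y (tangentCoordSymm p y w))

lemma velocity_coord {γ : ℝ → M} {t : ℝ}
    (hγ : MDifferentiableAt 𝓘(ℝ, ℝ) (𝓡 (2 * n + 1)) γ t)
    (ht : γ t ∈ (chartAt (EuclideanSpace ℝ (Fin (2 * n + 1))) p).source) :
    HasDerivAt (fun s => extChartAt (𝓡 (2 * n + 1)) p (γ s)) (tangentCoord p (γ t) (velocity γ t)) t := by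
  have h := hasDerivAt_comp_velocity (mdifferentiableAt_extChartAt (I := 𝓡 (2 * n + 1)) ht) hγ
  convert! h using 1
  rw [tangentCoord, TangentBundle.continuousLinearMapAt_trivializationAt ht]
  rfl

lemma velocity_eq {γ : ℝ → M} {t : ℝ}
    (hγ : MDifferentiableAt 𝓘(ℝ, ℝ) (𝓡 (2 * n + 1)) γ t)
    (ht : γ t ∈ (chartAt (EuclideanSpace ℝ (Fin (2 * n + 1))) p).source) :
    velocity γ t = tangentCoordSymm p (γ t) (deriv (fun s => extChartAt (𝓡 (2 * n + 1)) p (γ s)) t) := by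
  rw [(velocity_coord hγ ht).deriv, tangentCoordSymm_coord ht]

variable (cov : CovariantDerivative (𝓡 (2 * n + 1)) (EuclideanSpace ℝ (Fin (2 * n + 1)))
      (fun x : M => TangentSpace (𝓡 (2 * n + 1)) x))

/-- `covDerivAlong` uses the trivialization at the moving point `γ(t)`; this is its independence of
the chart, needed to treat the geodesic equation in one fixed chart. -/
lemma covDerivAlong_eq_coord {γ : ℝ → M} {V : ∀ t : ℝ, TangentSpace (𝓡 (2 * n + 1)) (γ t)} {t : ℝ}
    (hγ : MDifferentiableAt 𝓘(ℝ, ℝ) (𝓡 (2 * n + 1)) γ t)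
    (ht : γ t ∈ (chartAt (EuclideanSpace ℝ (Fin (2 * n + 1))) p).source)
    {a : EuclideanSpace ℝ (Fin (2 * n + 1))}
    (hV : HasDerivAt (fun s => tangentCoord p (γ s) (V s)) a t) :
    covDerivAlong cov γ V t = tangentCoordSymm p (γ t) (a +
      christoffel cov p (γ t) (tangentCoord p (γ t) (V t)) (tangentCoord p (γ t) (velocity γ t))) := by
  set e := trivializationAt (EuclideanSpace ℝ (Fin (2 * n + 1)))
    (TangentSpace (𝓡 (2 * n + 1)) : M → Type _) p
  set e' := trivializationAt (EuclideanSpace ℝ (Fin (2 * n + 1)))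
    (TangentSpace (𝓡 (2 * n + 1)) : M → Type _) (γ t)
  have ht' : γ t ∈ (chartAt (EuclideanSpace ℝ (Fin (2 * n + 1))) (γ t)).source :=
    mem_chart_source _ _
  let A : M → EuclideanSpace ℝ (Fin (2 * n + 1)) →L[ℝ] EuclideanSpace ℝ (Fin (2 * n + 1)) :=
    fun y => tangentCoord (γ t) y ∘L tangentCoordSymm p y
  have hA : MDifferentiableAt (𝓡 (2 * n + 1)) 𝓘(ℝ, EuclideanSpace ℝ (Fin (2 * n + 1)) →L[ℝ]
      EuclideanSpace ℝ (Fin (2 * n + 1))) A (γ t) := by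
    have h := (contMDiffAt_coordChangeL (IB := 𝓡 (2 * n + 1)) (n := ∞) (e := e) (e' := e')
      (x := γ t) ht ht').mdifferentiableAt (by simp)
    refine h.congr_of_eventuallyEq ?_
    filter_upwards [(chartAt _ p).open_source.mem_nhds ht, (chartAt _ (γ t)).open_source.mem_nhds ht']
      with y hy hy'
    ext1 u
    refine Eq.trans ?_ (e.coordChangeL_apply (R := ℝ) e' ⟨hy, hy'⟩ u).symm
    refine (trivializationAt_snd hy' _).symm.trans ?_
    rw [tangentCoordSymm]
    exact congrArg (fun z => (e' (⟨y, z⟩ : TangentBundle (𝓡 (2 * n + 1)) M)).2)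
      (e.symmL_apply (R := ℝ) hy u)
  have hev : ∀ᶠ s in 𝓝 t, γ s ∈ (chartAt (EuclideanSpace ℝ (Fin (2 * n + 1))) p).source ∧
      γ s ∈ (chartAt (EuclideanSpace ℝ (Fin (2 * n + 1))) (γ t)).source :=
    hγ.continuousAt.eventually (inter_mem ((chartAt _ p).open_source.mem_nhds ht)
      ((chartAt _ (γ t)).open_source.mem_nhds ht'))
  have hAγ : HasDerivAt (fun s => A (γ s)) (mvfderiv (𝓡 (2 * n + 1)) A (γ t) (velocity γ t)) t :=
    hasDerivAt_comp_velocity hA hγ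
  have hd : HasDerivAt (fun s => (e' (⟨γ s, V s⟩ : TangentBundle (𝓡 (2 * n + 1)) M)).2)
      (mvfderiv (𝓡 (2 * n + 1)) A (γ t) (velocity γ t) (tangentCoord p (γ t) (V t))
        + A (γ t) a) t := by
    refine (hAγ.clm_apply hV).congr_of_eventuallyEq ?_
    filter_upwards [hev] with s hs
    simp only [A, e', trivializationAt_snd hs.2, ContinuousLinearMap.comp_apply,
      tangentCoordSymm_coord hs.1]
  have hcf := contMDiffFieldAt_coordField ht (tangentCoord p (γ t) (V t))
  -- Differentiating the constant field of the chart at `p` in the chart at `γ(t)` gives the same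
  -- derivative of the transition map `A` as in `hd`; it is absorbed into the Christoffel term.
  have hc := cov.apply_eq_coord (hcf.mdiff (by simp)) ht' (velocity γ t)
  have hm : mvfderiv (𝓡 (2 * n + 1))
      (fun y => tangentCoord (γ t) y (coordField p (tangentCoord p (γ t) (V t)) y)) (γ t)
      (velocity γ t)
      = mvfderiv (𝓡 (2 * n + 1)) A (γ t) (velocity γ t) (tangentCoord p (γ t) (V t)) := by
    exact mvfderiv_clm_comp (ContinuousLinearMap.apply ℝ (EuclideanSpace ℝ (Fin (2 * n + 1)))
      (tangentCoord p (γ t) (V t))) hA _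
  have hx : cov (FiberBundle.extend (EuclideanSpace ℝ (Fin (2 * n + 1))) (V t)) (γ t)
      = cov (coordField (γ t) (tangentCoord (γ t) (γ t)
        (coordField p (tangentCoord p (γ t) (V t)) (γ t)))) (γ t) := by
    refine cov.congr_of_eventuallyEq_field
      ((contMDiffFieldAt_coordField ht' _).mdiff (by simp)) ?_
    filter_upwards [(chartAt _ (γ t)).open_source.mem_nhds ht'] with y hy
    rw [coordField, coordField, tangentCoordSymm_coord ht, ← trivializationAt_snd ht',
      tangentCoordSymm, e'.symmL_apply hy]
    rfl
  rw [hm, ← hx] at hc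
  rw [covDerivAlong, hd.deriv, christoffel, map_add, tangentCoordSymm_coord ht,
    tangentCoordSymm_coord ht, hc]
  rw [← e'.symmL_apply (R := ℝ) ht']
  change tangentCoordSymm (γ t) (γ t) _ + _ = _
  rw [map_add]
  simp only [A, ContinuousLinearMap.comp_apply, tangentCoordSymm_coord ht']
  abel

end Coordinates


/-! ### The geodesic equation as a smooth first order system. -/

section GeodesicEquation

variable {n : ℕ} {M : Type*} [TopologicalSpace M]
  [ChartedSpace (EuclideanSpace ℝ (Fin (2 * n + 1))) M]
  [IsManifold (𝓡 (2 * n + 1)) ∞ M]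
  (cov : CovariantDerivative (𝓡 (2 * n + 1)) (EuclideanSpace ℝ (Fin (2 * n + 1)))
      (fun x : M => TangentSpace (𝓡 (2 * n + 1)) x))

lemma coordField_add (p : M) (u v : EuclideanSpace ℝ (Fin (2 * n + 1))) :
    coordField p (u + v) = coordField p u + coordField p v := by
  ext1 y; simp [coordField]

lemma coordField_smul (p : M) (c : ℝ) (u : EuclideanSpace ℝ (Fin (2 * n + 1))) :
    coordField p (c • u) = c • coordField p u := by
  ext1 y; simp [coordField]

variable {p : M}

/-- The Christoffel symbol at a point of the chart at `p`, as a bilinear map. -/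
lemma christoffel_isLinearMap_left {y : M}
    (hy : y ∈ (chartAt (EuclideanSpace ℝ (Fin (2 * n + 1))) p).source)
    (w : EuclideanSpace ℝ (Fin (2 * n + 1))) : IsLinearMap ℝ (christoffel cov p y · w) where
  map_add u v := by
    have h := cov.isCovariantDerivativeOnUniv.add
      ((contMDiffFieldAt_coordField hy u).mdiff (by simp))
      ((contMDiffFieldAt_coordField hy v).mdiff (by simp))
    simp only [christoffel]
    rw [coordField_add]
    erw [h]
    simp
  map_smul c u := by
    have h := cov.isCovariantDerivativeOnUniv.smul_const c
      ((contMDiffFieldAt_coordField hy u).mdiff (by simp))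
    simp only [christoffel]
    rw [coordField_smul]
    erw [h]
    simp

lemma christoffel_smul_smul {y : M}
    (hy : y ∈ (chartAt (EuclideanSpace ℝ (Fin (2 * n + 1))) p).source) (c : ℝ)
    (u : EuclideanSpace ℝ (Fin (2 * n + 1))) :
    christoffel cov p y (c • u) (c • u) = c ^ 2 • christoffel cov p y u u := by
  have h : ∀ v w, christoffel cov p y v (c • w) = c • christoffel cov p y v w := by
    simp [christoffel]
  rw [h, (christoffel_isLinearMap_left cov hy u).map_smul, smul_smul, sq]

/-- The Christoffel symbol with its first argument fixed. -/
def christoffelL (p : M) (u : EuclideanSpace ℝ (Fin (2 * n + 1))) (y : M) :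
    EuclideanSpace ℝ (Fin (2 * n + 1)) →L[ℝ] EuclideanSpace ℝ (Fin (2 * n + 1)) :=
  tangentCoord p y ∘L (cov (coordField p u) y) ∘L tangentCoordSymm p y

/-- Smoothness at the centre `p` of the chart suffices, since local arguments near a point can use
the chart centred there. -/
lemma contMDiffAt_christoffelL [T2Space M]
    (hcov : CovariantDerivative.ContMDiffCovariantDerivative cov ∞) (p : M)
    (u : EuclideanSpace ℝ (Fin (2 * n + 1))) :
    ContMDiffAt (𝓡 (2 * n + 1)) 𝓘(ℝ, EuclideanSpace ℝ (Fin (2 * n + 1)) →L[ℝ]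
      EuclideanSpace ℝ (Fin (2 * n + 1))) ∞ (christoffelL cov p u) p := by
  have hp := eventually_contMDiffFieldAt_coordField (mem_chart_source
    (EuclideanSpace ℝ (Fin (2 * n + 1))) p) u
  obtain ⟨X, hX, hXu⟩ := exists_smoothField_eventuallyEq hp
  have hsm := (hcov.contMDiff.contMDiff (σ := X) (by
    exact contMDiffOn_univ.2 hX)).contMDiffAt (x := p) univ_mem
  have h2 := ((contMDiffAt_hom_bundle _).1 hsm).2
  refine h2.congr_of_eventuallyEq ?_
  filter_upwards [hXu.eventually_nhds, hp] with y hy hy'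
  have := cov.congr_of_eventuallyEq_field (hy'.mdiff (by simp)) hy
  rw [christoffelL, ← this]
  rfl

/-- The vector field on `E × E` whose integral curves are the geodesics in the chart at `p`,
together with their velocities. -/
def geodesicField (p : M)
    (z : EuclideanSpace ℝ (Fin (2 * n + 1)) × EuclideanSpace ℝ (Fin (2 * n + 1))) :
    EuclideanSpace ℝ (Fin (2 * n + 1)) × EuclideanSpace ℝ (Fin (2 * n + 1)) :=
  (z.2, - christoffel cov p ((extChartAt (𝓡 (2 * n + 1)) p).symm z.1) z.2 z.2)

/-- Expanding the first argument of the Christoffel symbol in a basis reduces the claim to the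
smooth maps `christoffelL cov p (b i)`. -/
lemma contDiffAt_geodesicField [T2Space M]
    (hcov : CovariantDerivative.ContMDiffCovariantDerivative cov ∞) (p : M)
    (v : EuclideanSpace ℝ (Fin (2 * n + 1))) :
    ContDiffAt ℝ ∞ (geodesicField cov p) (extChartAt (𝓡 (2 * n + 1)) p p, v) := by
  have htar : (extChartAt (𝓡 (2 * n + 1)) p).target ∈ 𝓝 (extChartAt (𝓡 (2 * n + 1)) p p) :=
    extChartAt_target_mem_nhds p
  have hC : ∀ u, ContDiffAt ℝ ∞ (fun x => christoffelL cov p u ((extChartAt (𝓡 (2 * n + 1)) p).symm x))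
      (extChartAt (𝓡 (2 * n + 1)) p p) := fun u => by
    rw [← contMDiffAt_iff_contDiffAt]
    refine ContMDiffAt.comp_of_eq (contMDiffAt_christoffelL cov hcov p u) ?_ (extChartAt_to_inv p)
    exact (contMDiffOn_extChartAt_symm p).contMDiffAt htar
  let b := EuclideanSpace.basisFun (Fin (2 * n + 1)) ℝ
  have hsum : ContDiffAt ℝ ∞ (fun z : EuclideanSpace ℝ (Fin (2 * n + 1)) ×
      EuclideanSpace ℝ (Fin (2 * n + 1)) => (z.2, - ∑ i, z.2 i •
        christoffelL cov p (b i) ((extChartAt (𝓡 (2 * n + 1)) p).symm z.1) z.2))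
      (extChartAt (𝓡 (2 * n + 1)) p p, v) := by
    refine contDiffAt_snd.prodMk (ContDiffAt.neg (ContDiffAt.sum fun i _ => ContDiffAt.fun_smul ?_ ?_))
    · exact ((EuclideanSpace.proj (𝕜 := ℝ) i).contDiff.comp contDiff_snd).contDiffAt
    · exact ContDiffAt.clm_apply ((hC (b i)).comp (_, v) contDiffAt_fst) contDiffAt_snd
  refine hsum.congr_of_eventuallyEq ?_
  filter_upwards [continuousAt_fst.eventually_mem htar] with z hz
  have hy : (extChartAt (𝓡 (2 * n + 1)) p).symm z.1 ∈
      (chartAt (EuclideanSpace ℝ (Fin (2 * n + 1))) p).source := by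
    simpa using (extChartAt (𝓡 (2 * n + 1)) p).map_target hz
  have hl := christoffel_isLinearMap_left cov hy z.2
  have hz2 : z.2 = ∑ i, z.2 i • b i := by
    simpa [b] using (b.sum_repr z.2).symm
  have : christoffel cov p ((extChartAt (𝓡 (2 * n + 1)) p).symm z.1) z.2 z.2 = ∑ i, z.2 i •
        christoffelL cov p (b i) ((extChartAt (𝓡 (2 * n + 1)) p).symm z.1) z.2 := by
    have h := map_sum (hl.mk' _) (fun i => z.2 i • b i) Finset.univ
    rw [← hz2] at h
    refine h.trans (Finset.sum_congr rfl fun i _ => ?_)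
    rw [map_smul]
    rfl
  rw [geodesicField, this]

/-- `γ` is of class `C^2` at `t` and satisfies `∇_{γ'} γ' = 0` at `t`. -/
def IsGeodesicAt (γ : ℝ → M) (t : ℝ) : Prop :=
  ContMDiffAt 𝓘(ℝ, ℝ) (𝓡 (2 * n + 1)) 2 γ t ∧ covDerivAlong cov γ (velocity γ) t = 0

lemma isGeodesicOn_iff {γ : ℝ → M} {s : Set ℝ} (hs : IsOpen s) :
    IsGeodesicOn cov γ s ↔ ∀ t ∈ s, IsGeodesicAt cov γ t :=
  ⟨fun h t ht => ⟨h.1.contMDiffAt (hs.mem_nhds ht), h.2 t ht⟩,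
    fun h => ⟨fun t ht => (h t ht).1.contMDiffWithinAt, fun t ht => (h t ht).2⟩⟩

lemma ContMDiffAt.contDiffAt_extChartAt_comp {k : ℕ∞ω} (hk : k ≤ (∞ : ℕ∞ω)) {γ : ℝ → M} {t : ℝ}
    (hγ : ContMDiffAt 𝓘(ℝ, ℝ) (𝓡 (2 * n + 1)) k γ t)
    (ht : γ t ∈ (chartAt (EuclideanSpace ℝ (Fin (2 * n + 1))) p).source) :
    ContDiffAt ℝ k (fun s => extChartAt (𝓡 (2 * n + 1)) p (γ s)) t := by
  rw [← contMDiffAt_iff_contDiffAt]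
  have h : ContMDiffAt (𝓡 (2 * n + 1)) 𝓘(ℝ, EuclideanSpace ℝ (Fin (2 * n + 1))) ∞
    (extChartAt (𝓡 (2 * n + 1)) p) (γ t) := contMDiffAt_extChartAt' ht
  exact (h.of_le hk).comp t hγ

lemma isGeodesicAt_iff {γ : ℝ → M} {t : ℝ}
    (ht : γ t ∈ (chartAt (EuclideanSpace ℝ (Fin (2 * n + 1))) p).source) :
    IsGeodesicAt cov γ t ↔ ContMDiffAt 𝓘(ℝ, ℝ) (𝓡 (2 * n + 1)) 2 γ t ∧
      deriv (deriv fun s => extChartAt (𝓡 (2 * n + 1)) p (γ s)) t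
        = - christoffel cov p (γ t) (deriv (fun s => extChartAt (𝓡 (2 * n + 1)) p (γ s)) t)
          (deriv (fun s => extChartAt (𝓡 (2 * n + 1)) p (γ s)) t) := by
  refine and_congr_right fun hγ => ?_
  set x : ℝ → EuclideanSpace ℝ (Fin (2 * n + 1)) := fun s => extChartAt (𝓡 (2 * n + 1)) p (γ s)
  have hx : ContDiffAt ℝ 2 x t := hγ.contDiffAt_extChartAt_comp ENat.LEInfty.out ht
  have hmd : ∀ᶠ s in 𝓝 t, MDifferentiableAt 𝓘(ℝ, ℝ) (𝓡 (2 * n + 1)) γ s := by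
    filter_upwards [(contMDiffAt_iff_contMDiffAt_nhds (by simp)).1 hγ] with s hs
      using hs.mdifferentiableAt (by simp)
  have hsrc : ∀ᶠ s in 𝓝 t, γ s ∈ (chartAt (EuclideanSpace ℝ (Fin (2 * n + 1))) p).source :=
    hγ.continuousAt.eventually ((chartAt _ p).open_source.mem_nhds ht)
  have hV : (fun s => tangentCoord p (γ s) (velocity γ s)) =ᶠ[𝓝 t] deriv x := by
    filter_upwards [hmd, hsrc] with s h1 h2 using (velocity_coord h1 h2).deriv.symm
  have hd : HasDerivAt (deriv x) (deriv (deriv x) t) t := by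
    have : ContDiffAt ℝ 1 (deriv x) t := by
      exact (hx.fderiv_right (m := 1) (by norm_num)).clm_apply contDiffAt_const
    exact (this.differentiableAt (by simp)).hasDerivAt
  rw [covDerivAlong_eq_coord cov hmd.self_of_nhds ht (hd.congr_of_eventuallyEq hV),
    (velocity_coord hmd.self_of_nhds ht).deriv.symm, ← add_eq_zero_iff_eq_neg]
  constructor
  · intro h
    have := congrArg (tangentCoord p (γ t)) h
    rwa [tangentCoord_symm ht, map_zero] at this
  · intro h
    rw [h, map_zero]

variable {cov}

lemma IsGeodesicAt.congr {γ γ' : ℝ → M} {t : ℝ} (h : IsGeodesicAt cov γ t) (hγ : γ' =ᶠ[𝓝 t] γ) :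
    IsGeodesicAt cov γ' t := by
  have ht : γ t ∈ (chartAt (EuclideanSpace ℝ (Fin (2 * n + 1))) (γ t)).source := mem_chart_source _ _
  have ht' : γ' t ∈ (chartAt (EuclideanSpace ℝ (Fin (2 * n + 1))) (γ t)).source := by
    rw [hγ.self_of_nhds]; exact ht
  rw [isGeodesicAt_iff cov ht] at h
  rw [isGeodesicAt_iff cov ht']
  refine ⟨h.1.congr_of_eventuallyEq hγ, ?_⟩
  have hx : (fun s => extChartAt (𝓡 (2 * n + 1)) (γ t) (γ' s)) =ᶠ[𝓝 t]
      fun s => extChartAt (𝓡 (2 * n + 1)) (γ t) (γ s) := hγ.fun_comp _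
  rw [hx.deriv.deriv_eq, hx.deriv_eq, hγ.self_of_nhds]
  exact h.2

/-- Both sides of `x'' = -Γ(x', x')` scale by `c²`; the case `c = 0` is included. -/
lemma IsGeodesicAt.comp_affine {γ : ℝ → M} {c d t : ℝ} (h : IsGeodesicAt cov γ (c * t + d)) :
    IsGeodesicAt cov (fun s => γ (c * s + d)) t := by
  have ht : γ (c * t + d) ∈
    (chartAt (EuclideanSpace ℝ (Fin (2 * n + 1))) (γ (c * t + d))).source := mem_chart_source _ _
  rw [isGeodesicAt_iff cov ht] at h
  refine (isGeodesicAt_iff cov (γ := fun s => γ (c * s + d)) ht).2 ?_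
  set x : ℝ → EuclideanSpace ℝ (Fin (2 * n + 1)) :=
    fun s => extChartAt (𝓡 (2 * n + 1)) (γ (c * t + d)) (γ s)
  have hd : ∀ f : ℝ → EuclideanSpace ℝ (Fin (2 * n + 1)), (deriv fun s => f (c * s + d)) =
      fun s => c • deriv f (c * s + d) := fun f => by
    ext1 s
    rw [deriv_comp_mul_left c (fun r => f (r + d)) s, deriv_comp_add_const]
  refine ⟨ContMDiffAt.comp (f := fun s : ℝ => c * s + d) t h.1 ?_, ?_⟩
  · rw [contMDiffAt_iff_contDiffAt]; fun_prop
  · have h1 := hd x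
    have h2 : deriv (deriv fun s => x (c * s + d)) t = c ^ 2 • deriv (deriv x) (c * t + d) := by
      rw [h1, deriv_fun_const_smul_field, hd (deriv x), smul_smul, sq]
    change deriv (deriv fun s => x (c * s + d)) t = - christoffel cov _ _
      (deriv (fun s => x (c * s + d)) t) (deriv (fun s => x (c * s + d)) t)
    rw [h2, h1, christoffel_smul_smul cov ht, h.2, smul_neg]

omit [IsManifold (𝓡 (2 * n + 1)) ∞ M] in
lemma velocity_comp_affine {γ : ℝ → M} {c d t : ℝ}
    (h : MDifferentiableAt 𝓘(ℝ, ℝ) (𝓡 (2 * n + 1)) γ (c * t + d)) :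
    velocity (n := n) (fun s => γ (c * s + d)) t = c • velocity γ (c * t + d) := by
  have hl : HasDerivAt (fun s : ℝ => c * s + d) c t := by
    simpa using ((hasDerivAt_id t).const_mul c).add_const d
  have := (HasMFDerivAt.comp (f := fun s : ℝ => c * s + d) t h.hasMFDerivAt
    hl.hasFDerivAt.hasMFDerivAt).mfderiv
  simp only [velocity]
  erw [this]
  change mfderiv 𝓘(ℝ, ℝ) (𝓡 (2 * n + 1)) γ (c * t + d) ((1 : ℝ) • c) = _
  rw [one_smul]
  refine (congrArg (mfderiv 𝓘(ℝ, ℝ) (𝓡 (2 * n + 1)) γ (c * t + d))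
    (show c = c • (1 : ℝ) by simp)).trans ?_
  exact map_smul (mfderiv 𝓘(ℝ, ℝ) (𝓡 (2 * n + 1)) γ (c * t + d)) c (1 : ℝ)

/-- Coordinates in one trivialization compare vectors in different fibres without transport. -/
lemma tangentBundle_mk_eq_iff {a b : M} {v : TangentSpace (𝓡 (2 * n + 1)) a}
    {w : TangentSpace (𝓡 (2 * n + 1)) b}
    (ha : a ∈ (chartAt (EuclideanSpace ℝ (Fin (2 * n + 1))) p).source) :
    (⟨a, v⟩ : TangentBundle (𝓡 (2 * n + 1)) M) = ⟨b, w⟩ ↔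
      a = b ∧ tangentCoord p a v = tangentCoord p b w := by
  constructor
  · intro h
    cases h
    exact ⟨rfl, rfl⟩
  · rintro ⟨rfl, h⟩
    have := congrArg (tangentCoordSymm p a) h
    rw [tangentCoordSymm_coord ha, tangentCoordSymm_coord ha] at this
    rw [this]

end GeodesicEquation


/-! ### Uniform local existence for ordinary differential equations. -/

/-- A `C^1` vector field has, for initial points near `x₀`, integral curves which stay, for a
uniform time, in a prescribed neighbourhood of `x₀`. -/
lemma ContDiffAt.exists_integralCurve_mem {E : Type*} [NormedAddCommGroup E] [NormedSpace ℝ E]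
    [CompleteSpace E] {f : E → E} {x₀ : E} (hf : ContDiffAt ℝ 1 f x₀) {U : Set E} (hU : U ∈ 𝓝 x₀) :
    ∃ r > (0 : ℝ), ∃ ε > (0 : ℝ), ∀ x ∈ Metric.closedBall x₀ r, ∃ α : ℝ → E, α 0 = x ∧
      ∀ t ∈ Ioo (-ε) ε, HasDerivAt α (f (α t)) t ∧ α t ∈ U := by
  obtain ⟨ε, hε, a, r, L, K, hr, hpl⟩ := IsPicardLindelof.of_contDiffAt_one hf
  obtain ⟨α, hα, hc⟩ := (hpl 0).exists_forall_mem_closedBall_eq_hasDerivWithinAt_continuousOn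
  simp only [zero_sub, zero_add] at hα hc
  have hr' : (0 : ℝ) < r := hr
  have hnhds : Metric.closedBall x₀ r ×ˢ Icc (-ε) ε ∈ 𝓝 (x₀, (0 : ℝ)) :=
    prod_mem_nhds (Metric.closedBall_mem_nhds _ hr') (Icc_mem_nhds (by linarith) hε)
  have hca : ContinuousAt α (x₀, 0) := hc.continuousAt hnhds
  have h0 : α (x₀, 0) = x₀ := (hα x₀ (Metric.mem_closedBall_self hr'.le)).1
  have hmem : ∀ᶠ z in 𝓝 (x₀, (0 : ℝ)), α z ∈ U ∧ z ∈ Metric.closedBall x₀ r ×ˢ Ioo (-ε) ε :=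
    (hca.eventually_mem (by rwa [h0])).and
      (prod_mem_nhds (Metric.closedBall_mem_nhds _ hr') (Ioo_mem_nhds (by linarith) hε))
  -- Joint continuity of the local flow at `(x₀, 0)` lets one `δ` bound both the initial
  -- displacement and the time.
  obtain ⟨δ, hδ, hδs⟩ := Metric.nhds_basis_closedBall.mem_iff.1 hmem
  refine ⟨δ, hδ, δ, hδ, fun x hx => ⟨fun t => α (x, t), ?_, fun t ht => ?_⟩⟩
  · have hx' := (@hδs (x, 0) (by
      rw [← closedBall_prod_same]; exact ⟨hx, Metric.mem_closedBall_self hδ.le⟩)).2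
    exact (hα x hx'.1).1
  · have hxt := @hδs (x, t) (by
      rw [← closedBall_prod_same]
      refine ⟨hx, ?_⟩
      rw [mem_closedBall_zero_iff, Real.norm_eq_abs, abs_le]
      exact ⟨ht.1.le, ht.2.le⟩)
    exact ⟨((hα x hxt.2.1).2 t (Ioo_subset_Icc_self hxt.2.2)).hasDerivAt
      (Icc_mem_nhds hxt.2.2.1 hxt.2.2.2), hxt.1⟩

/-! ### Uniqueness and local existence of geodesics. -/

section GeodesicFlow

variable {n : ℕ} {M : Type*} [TopologicalSpace M]
  [ChartedSpace (EuclideanSpace ℝ (Fin (2 * n + 1))) M]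
  [IsManifold (𝓡 (2 * n + 1)) ∞ M]
  {cov : CovariantDerivative (𝓡 (2 * n + 1)) (EuclideanSpace ℝ (Fin (2 * n + 1)))
      (fun x : M => TangentSpace (𝓡 (2 * n + 1)) x)} {p : M}

/-- A curve and its derivative in the chart at `p`. -/
def chartJet (p : M) (γ : ℝ → M) (s : ℝ) :
    EuclideanSpace ℝ (Fin (2 * n + 1)) × EuclideanSpace ℝ (Fin (2 * n + 1)) :=
  (extChartAt (𝓡 (2 * n + 1)) p (γ s), deriv (fun r => extChartAt (𝓡 (2 * n + 1)) p (γ r)) s)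

lemma IsGeodesicAt.mdifferentiableAt {γ : ℝ → M} {t : ℝ} (h : IsGeodesicAt cov γ t) :
    MDifferentiableAt 𝓘(ℝ, ℝ) (𝓡 (2 * n + 1)) γ t := h.1.mdifferentiableAt (by simp)

lemma IsGeodesicAt.hasDerivAt_chartJet {γ : ℝ → M} {t : ℝ} (h : IsGeodesicAt cov γ t)
    (ht : γ t ∈ (chartAt (EuclideanSpace ℝ (Fin (2 * n + 1))) p).source) :
    HasDerivAt (chartJet p γ) (geodesicField cov p (chartJet p γ t)) t := by
  have hx := h.1.contDiffAt_extChartAt_comp ENat.LEInfty.out ht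
  have hd : ContDiffAt ℝ 1 (deriv fun r => extChartAt (𝓡 (2 * n + 1)) p (γ r)) t := by
    exact (hx.fderiv_right (m := 1) (by norm_num)).clm_apply contDiffAt_const
  have h1 := (hx.differentiableAt (by simp)).hasDerivAt.prodMk
    (hd.differentiableAt (by simp)).hasDerivAt
  rw [((isGeodesicAt_iff cov ht).1 h).2] at h1
  convert! h1 using 1
  rw [geodesicField, chartJet]
  have : (extChartAt (𝓡 (2 * n + 1)) p).symm (extChartAt (𝓡 (2 * n + 1)) p (γ t)) = γ t :=
    (extChartAt (𝓡 (2 * n + 1)) p).left_inv (by simpa using ht)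
  simp only [this]

lemma chartJet_eq {γ : ℝ → M} {t : ℝ}
    (hγ : MDifferentiableAt 𝓘(ℝ, ℝ) (𝓡 (2 * n + 1)) γ t)
    (ht : γ t ∈ (chartAt (EuclideanSpace ℝ (Fin (2 * n + 1))) p).source) :
    chartJet p γ t = (extChartAt (𝓡 (2 * n + 1)) p (γ t), tangentCoord p (γ t) (velocity γ t)) := by
  rw [chartJet, (velocity_coord hγ ht).deriv]

variable [T2Space M]

lemma eventuallyEq_of_isGeodesicAt (hcov : CovariantDerivative.ContMDiffCovariantDerivative cov ∞)
    {γ γ' : ℝ → M} {t : ℝ} (h : ∀ᶠ s in 𝓝 t, IsGeodesicAt cov γ s)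
    (h' : ∀ᶠ s in 𝓝 t, IsGeodesicAt cov γ' s) (heq : γ t = γ' t)
    (hjet : chartJet (n := n) (γ t) γ t = chartJet (γ t) γ' t) : γ =ᶠ[𝓝 t] γ' := by
  set p := γ t
  have hsrc : ∀ {β : ℝ → M}, (∀ᶠ s in 𝓝 t, IsGeodesicAt cov β s) → p = β t →
      ∀ᶠ s in 𝓝 t, β s ∈ (chartAt (EuclideanSpace ℝ (Fin (2 * n + 1))) p).source := by
    intro β hβ hp
    refine hβ.self_of_nhds.1.continuousAt.eventually ((chartAt _ p).open_source.mem_nhds ?_)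
    rw [← hp]; exact mem_chart_source _ _
  obtain ⟨K, U, hU, hlip⟩ := ((contDiffAt_geodesicField cov hcov p
    (chartJet p γ t).2).of_le (m := 1) (by simp)).exists_lipschitzOnWith
  have hsol : ∀ {β : ℝ → M}, (∀ᶠ s in 𝓝 t, IsGeodesicAt cov β s) → p = β t →
      chartJet (n := n) p γ t = chartJet p β t → ∀ᶠ s in 𝓝 t,
        HasDerivAt (chartJet p β) (geodesicField cov p (chartJet p β s)) s ∧
          chartJet p β s ∈ U := by
    intro β hβ hp hj
    have hs := hsrc hβ hp
    refine ((hβ.and hs).mono fun s hs => hs.1.hasDerivAt_chartJet hs.2).and ?_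
    refine (hβ.self_of_nhds.hasDerivAt_chartJet hs.self_of_nhds).continuousAt.eventually_mem ?_
    rw [← hj]
    exact hU
  have key := ODE_solution_unique_of_eventually (v := fun _ => geodesicField cov p)
    (s := fun _ => U) (Eventually.of_forall fun _ => hlip) (hsol h rfl rfl) (hsol h' heq hjet) hjet
  filter_upwards [key, hsrc h rfl, hsrc h' heq] with s hs h1 h2
  refine (extChartAt (𝓡 (2 * n + 1)) p).injOn (by simpa using h1) (by simpa using h2) ?_
  exact congrArg Prod.fst hs

/-- The set of times near which the curves coincide is open by definition and relatively closed in
`s` by continuity of the jets and local uniqueness; connectedness finishes. -/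
theorem eqOn_of_isGeodesicAt (hcov : CovariantDerivative.ContMDiffCovariantDerivative cov ∞)
    {γ γ' : ℝ → M} {s : Set ℝ} (hs : IsPreconnected s) (hso : IsOpen s)
    (h : ∀ t ∈ s, IsGeodesicAt cov γ t) (h' : ∀ t ∈ s, IsGeodesicAt cov γ' t) {t₀ : ℝ}
    (ht₀ : t₀ ∈ s) (hjet : (⟨γ t₀, velocity γ t₀⟩ : TangentBundle (𝓡 (2 * n + 1)) M)
      = ⟨γ' t₀, velocity γ' t₀⟩) : EqOn γ γ' s := by
  let u : Set ℝ := {t | γ =ᶠ[𝓝 t] γ'}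
  have hev : ∀ {β : ℝ → M}, (∀ t ∈ s, IsGeodesicAt cov β t) → ∀ t ∈ s,
      ∀ᶠ r in 𝓝 t, IsGeodesicAt cov β r := fun hβ t ht =>
    eventually_of_mem (hso.mem_nhds ht) hβ
  have hsub : s ⊆ u := by
    refine hs.subset_of_closure_inter_subset isOpen_setOfPred_eventually_nhds ⟨t₀, ht₀, ?_⟩ ?_
    · have h0 : γ t₀ ∈ (chartAt (EuclideanSpace ℝ (Fin (2 * n + 1))) (γ t₀)).source :=
        mem_chart_source _ _
      obtain ⟨h1, h2⟩ := (tangentBundle_mk_eq_iff h0).1 hjet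
      refine eventuallyEq_of_isGeodesicAt hcov (hev h _ ht₀) (hev h' _ ht₀) h1 ?_
      rw [chartJet_eq (h _ ht₀).mdifferentiableAt h0, h2, h1,
        chartJet_eq (h' _ ht₀).mdifferentiableAt (mem_chart_source _ _)]
    -- At a limit time, positions agree because `M` is Hausdorff, and chart velocities agree because
    -- they are continuous and agree at times arbitrarily close to `t`.
    · rintro t ⟨htu, hts⟩
      have hfr : ∃ᶠ r in 𝓝 t, r ∈ u := mem_closure_iff_frequently.1 htu
      have heq : γ t = γ' t := by
        by_contra hne
        have := ((h t hts).1.continuousAt.prodMk (h' t hts).1.continuousAt).eventually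
          (isClosed_diagonal.isOpen_compl.mem_nhds hne)
        exact hfr (this.mono fun r hr hru => hr hru.self_of_nhds)
      have h0 : γ t ∈ (chartAt (EuclideanSpace ℝ (Fin (2 * n + 1))) (γ t)).source :=
        mem_chart_source _ _
      refine eventuallyEq_of_isGeodesicAt hcov (hev h _ hts) (hev h' _ hts) heq ?_
      by_contra hne
      have := ((h t hts).hasDerivAt_chartJet h0).continuousAt.prodMk
        ((h' t hts).hasDerivAt_chartJet (p := γ t) (by rw [← heq]; exact h0)).continuousAt
        |>.eventually (isClosed_diagonal.isOpen_compl.mem_nhds hne)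
      refine hfr (this.mono fun r hr hru => hr ?_)
      have hx : (fun s => extChartAt (𝓡 (2 * n + 1)) (γ t) (γ s)) =ᶠ[𝓝 r]
        fun s => extChartAt (𝓡 (2 * n + 1)) (γ t) (γ' s) := Filter.EventuallyEq.fun_comp hru _
      exact Prod.ext hx.self_of_nhds hx.deriv_eq
  exact fun t ht => (hsub ht).self_of_nhds

omit [T2Space M] in
/-- Integral curves of the geodesic field are geodesics in the chart. -/
lemma isGeodesicAt_of_hasDerivAt {α : ℝ → EuclideanSpace ℝ (Fin (2 * n + 1)) ×
      EuclideanSpace ℝ (Fin (2 * n + 1))} {s : Set ℝ} (hs : IsOpen s)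
    (hα : ∀ t ∈ s, HasDerivAt α (geodesicField cov p (α t)) t)
    (hc : ∀ t ∈ s, ContinuousAt (geodesicField cov p) (α t))
    (htar : ∀ t ∈ s, (α t).1 ∈ (extChartAt (𝓡 (2 * n + 1)) p).target) {t : ℝ} (ht : t ∈ s) :
    IsGeodesicAt cov (fun r => (extChartAt (𝓡 (2 * n + 1)) p).symm (α r).1) t ∧
    velocity (n := n) (fun r => (extChartAt (𝓡 (2 * n + 1)) p).symm (α r).1) t
      = tangentCoordSymm p ((extChartAt (𝓡 (2 * n + 1)) p).symm (α t).1) (α t).2 := by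
  have h1 : ∀ t ∈ s, HasDerivAt (fun r => (α r).1) (α t).2 t := fun t ht => (hα t ht).fst
  have h2 : ∀ t ∈ s, HasDerivAt (fun r => (α r).2) (geodesicField cov p (α t)).2 t :=
    fun t ht => (hα t ht).snd
  -- Bootstrapping: continuity of the field makes the second component `C^1`, and the first, being
  -- its primitive, is then `C^2`.
  have hC1 : ContDiffOn ℝ 1 (fun r => (α r).2) s := by
    have : ContDiffOn ℝ (0 + 1) (fun r => (α r).2) s := by
      rw [contDiffOn_succ_iff_deriv_of_isOpen hs]
      refine ⟨fun t ht => (h2 t ht).differentiableAt.differentiableWithinAt, by simp, ?_⟩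
      rw [contDiffOn_zero]
      refine ContinuousOn.congr (f := fun t => (geodesicField cov p (α t)).2) (fun t ht => ?_)
        fun t ht => (h2 t ht).deriv
      exact (continuousAt_snd.comp ((hc t ht).comp (hα t ht).continuousAt)).continuousWithinAt
    simpa using this
  have hC2 : ContDiffOn ℝ 2 (fun r => (α r).1) s := by
    have : ContDiffOn ℝ (1 + 1) (fun r => (α r).1) s := by
      rw [contDiffOn_succ_iff_deriv_of_isOpen hs]
      exact ⟨fun t ht => (h1 t ht).differentiableAt.differentiableWithinAt, by simp,
        hC1.congr fun t ht => (h1 t ht).deriv⟩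
    simpa [one_add_one_eq_two] using this
  have hM : ContMDiffAt 𝓘(ℝ, ℝ) (𝓡 (2 * n + 1)) 2
      (fun r => (extChartAt (𝓡 (2 * n + 1)) p).symm (α r).1) t := by
    have ha : ContMDiffAt 𝓘(ℝ, ℝ) 𝓘(ℝ, EuclideanSpace ℝ (Fin (2 * n + 1))) 2
        (fun r => (α r).1) t := contMDiffAt_iff_contDiffAt.2 (hC2.contDiffAt (hs.mem_nhds ht))
    have hb : ContMDiffAt 𝓘(ℝ, EuclideanSpace ℝ (Fin (2 * n + 1))) (𝓡 (2 * n + 1)) ∞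
        (extChartAt (𝓡 (2 * n + 1)) p).symm (α t).1 :=
      (contMDiffOn_extChartAt_symm p).contMDiffAt
        ((isOpen_extChartAt_target p).mem_nhds (htar t ht))
    exact (hb.of_le ENat.LEInfty.out).comp t ha
  have hsrc : (extChartAt (𝓡 (2 * n + 1)) p).symm (α t).1 ∈
      (chartAt (EuclideanSpace ℝ (Fin (2 * n + 1))) p).source := by
    simpa using (extChartAt (𝓡 (2 * n + 1)) p).map_target (htar t ht)
  have hx : EqOn (fun r => extChartAt (𝓡 (2 * n + 1)) p
      ((extChartAt (𝓡 (2 * n + 1)) p).symm (α r).1)) (fun r => (α r).1) s := fun r hr =>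
    (extChartAt (𝓡 (2 * n + 1)) p).right_inv (htar r hr)
  have hd : EqOn (deriv (fun r => extChartAt (𝓡 (2 * n + 1)) p
      ((extChartAt (𝓡 (2 * n + 1)) p).symm (α r).1))) (fun r => (α r).2) s := fun r hr => by
    rw [(hx.eventuallyEq_of_mem (hs.mem_nhds hr)).deriv_eq, (h1 r hr).deriv]
  constructor
  · refine (isGeodesicAt_iff cov
      (γ := fun r => (extChartAt (𝓡 (2 * n + 1)) p).symm (α r).1) hsrc).2 ⟨hM, ?_⟩
    rw [(hd.eventuallyEq_of_mem (hs.mem_nhds ht)).deriv_eq, hd ht, (h2 t ht).deriv, geodesicField]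
  · rw [velocity_eq (hM.mdifferentiableAt (by simp)) hsrc, hd ht]

/-- The existence theorem is applied around the zero vector at `p`, so it only reaches small
velocities; rescaling time removes that bound. -/
lemma exists_geodesic_of_norm_le_small
    (hcov : CovariantDerivative.ContMDiffCovariantDerivative cov ∞) (p : M) :
    ∃ r > (0 : ℝ), ∃ ε > (0 : ℝ), ∀ᶠ q in 𝓝 p, ∀ u : EuclideanSpace ℝ (Fin (2 * n + 1)), ‖u‖ ≤ r →
      ∃ γ : ℝ → M, (∀ t ∈ Ioo (-ε) ε, IsGeodesicAt cov γ t) ∧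
        (⟨γ 0, velocity γ 0⟩ : TangentBundle (𝓡 (2 * n + 1)) M) = ⟨q, tangentCoordSymm p q u⟩ := by
  have hf := (contDiffAt_geodesicField cov hcov p 0).of_le (m := 1) (by simp)
  have hU : {z : EuclideanSpace ℝ (Fin (2 * n + 1)) × EuclideanSpace ℝ (Fin (2 * n + 1)) |
      z.1 ∈ (extChartAt (𝓡 (2 * n + 1)) p).target ∧ ContinuousAt (geodesicField cov p) z} ∈
      𝓝 (extChartAt (𝓡 (2 * n + 1)) p p, (0 : EuclideanSpace ℝ (Fin (2 * n + 1)))) := by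
    filter_upwards [hf.eventually (by simp), prod_mem_nhds
      (extChartAt_target_mem_nhds (I := 𝓡 (2 * n + 1)) p) univ_mem] with z hz hz'
      using ⟨hz'.1, hz.continuousAt⟩
  obtain ⟨r, hr, ε, hε, H⟩ := hf.exists_integralCurve_mem hU
  refine ⟨r, hr, ε, hε, ?_⟩
  have h1 : ∀ᶠ q in 𝓝 p, extChartAt (𝓡 (2 * n + 1)) p q ∈
      Metric.closedBall (extChartAt (𝓡 (2 * n + 1)) p p) r :=
    (continuousAt_extChartAt p).eventually_mem (Metric.closedBall_mem_nhds _ hr)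
  filter_upwards [h1, extChartAt_source_mem_nhds (I := 𝓡 (2 * n + 1)) p] with q hq hqs u hu
  obtain ⟨α, hα0, hα⟩ := H (extChartAt (𝓡 (2 * n + 1)) p q, u) (by
    rw [← closedBall_prod_same]; exact ⟨hq, by simpa using hu⟩)
  have key := fun t (ht : t ∈ Ioo (-ε) ε) => isGeodesicAt_of_hasDerivAt isOpen_Ioo
    (fun t ht => (hα t ht).1) (fun t ht => (hα t ht).2.2) (fun t ht => (hα t ht).2.1) ht
  refine ⟨_, fun t ht => (key t ht).1, ?_⟩
  rw [(key 0 ⟨by linarith, hε⟩).2]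
  have : (extChartAt (𝓡 (2 * n + 1)) p).symm (α 0).1 = q := by
    rw [hα0]; exact (extChartAt (𝓡 (2 * n + 1)) p).left_inv hqs
  have h2 : ∀ a, a = q → (⟨a, tangentCoordSymm p a (α 0).2⟩ : TangentBundle (𝓡 (2 * n + 1)) M)
      = ⟨q, tangentCoordSymm p q u⟩ := by rintro _ rfl; rw [hα0]
  exact h2 _ this

/-- Geodesics with bounded initial velocity exist for a locally uniform time. -/
lemma exists_geodesic_of_norm_le
    (hcov : CovariantDerivative.ContMDiffCovariantDerivative cov ∞) (p : M) (R : ℝ) :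
    ∃ ε > (0 : ℝ), ∀ᶠ q in 𝓝 p, ∀ u : EuclideanSpace ℝ (Fin (2 * n + 1)), ‖u‖ ≤ R →
      ∃ γ : ℝ → M, (∀ t ∈ Ioo (-ε) ε, IsGeodesicAt cov γ t) ∧
        (⟨γ 0, velocity γ 0⟩ : TangentBundle (𝓡 (2 * n + 1)) M) = ⟨q, tangentCoordSymm p q u⟩ := by
  obtain ⟨r, hr, ε, hε, H⟩ := exists_geodesic_of_norm_le_small hcov p
  -- Speed is traded for time: the geodesic with velocity `c • u`, run at rate `c⁻¹`, has velocity
  -- `u` and lives for time `c * ε`.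
  obtain ⟨c, hc, hcR⟩ : ∃ c : ℝ, 0 < c ∧ c * R ≤ r := by
    refine ⟨r / (|R| + 1), by positivity, ?_⟩
    rw [div_mul_eq_mul_div, div_le_iff₀ (by positivity)]
    nlinarith [le_abs_self R]
  refine ⟨c * ε, by positivity, ?_⟩
  filter_upwards [H] with q hq u hu
  obtain ⟨γ, hγ, hγ0⟩ := hq (c • u) (by
    rw [norm_smul, Real.norm_of_nonneg hc.le]; nlinarith)
  have hmaps : ∀ t ∈ Ioo (-(c * ε)) (c * ε), c⁻¹ * t + 0 ∈ Ioo (-ε) ε := fun t ht => by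
    have h1 : c * (c⁻¹ * t + 0) = t := by field_simp; ring
    constructor <;> refine lt_of_mul_lt_mul_left ?_ hc.le <;> rw [h1]
    · linarith [ht.1]
    · exact ht.2
  refine ⟨fun s => γ (c⁻¹ * s + 0), fun t ht => (hγ _ (hmaps t ht)).comp_affine, ?_⟩
  have h0 := hmaps 0 ⟨by nlinarith, by positivity⟩
  rw [velocity_comp_affine (hγ _ h0).mdifferentiableAt]
  have e0 : c⁻¹ * 0 + 0 = (0 : ℝ) := by simp
  have h1 : ∀ a, a = 0 → (⟨γ a, c⁻¹ • velocity γ a⟩ : TangentBundle (𝓡 (2 * n + 1)) M)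
      = ⟨γ 0, c⁻¹ • velocity γ 0⟩ := by rintro _ rfl; rfl
  have hmap := congrArg (fun z : TangentBundle (𝓡 (2 * n + 1)) M =>
    (⟨z.1, c⁻¹ • z.2⟩ : TangentBundle (𝓡 (2 * n + 1)) M)) hγ0
  simp only [map_smul, smul_smul, inv_mul_cancel₀ hc.ne', one_smul] at hmap
  exact (h1 _ e0).trans hmap

end GeodesicFlow


/-! ### Conservation of speed and of horizontality; uniform existence time. -/

lemma differentiableAt_of_clm_apply {ι : Type*} [Fintype ι] {G : Type*} [NormedAddCommGroup G]
    [NormedSpace ℝ G] {c : ℝ → EuclideanSpace ℝ ι →L[ℝ] G} {t : ℝ}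
    (h : ∀ u, DifferentiableAt ℝ (fun s => c s u) t) : DifferentiableAt ℝ c t := by
  let b := EuclideanSpace.basisFun ι ℝ
  have hc : c = fun s => ∑ i, (ContinuousLinearMap.smulRightL ℝ (EuclideanSpace ℝ ι) G
      (EuclideanSpace.proj i)) (c s (b i)) := by
    ext s u
    have hu : u = ∑ i, u i • b i := by simpa [b] using (b.sum_repr u).symm
    conv_lhs => rw [hu]
    simp
  rw [hc]
  exact DifferentiableAt.fun_sum fun i _ =>
    (ContinuousLinearMap.differentiableAt _).comp t (h (b i))

instance bilinNormedAddCommGroup (n : ℕ) : NormedAddCommGroup (EuclideanSpace ℝ (Fin n) →L[ℝ]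
    EuclideanSpace ℝ (Fin n) →L[ℝ] ℝ) := ContinuousLinearMap.toNormedAddCommGroup

instance bilinNormedSpace (n : ℕ) : NormedSpace ℝ (EuclideanSpace ℝ (Fin n) →L[ℝ]
    EuclideanSpace ℝ (Fin n) →L[ℝ] ℝ) := ContinuousLinearMap.toNormedSpace

namespace PseudohermitianStructure
variable {n : ℕ} {M : Type*} [TopologicalSpace M]
  [ChartedSpace (EuclideanSpace ℝ (Fin (2 * n + 1))) M]
  [IsManifold (𝓡 (2 * n + 1)) ∞ M] (S : PseudohermitianStructure n M)

/-- The Webster metric in the trivialization of `T(M)` at `p`. -/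
def websterCoord (p y : M) : EuclideanSpace ℝ (Fin (2 * n + 1)) →L[ℝ]
    EuclideanSpace ℝ (Fin (2 * n + 1)) →L[ℝ] ℝ :=
  (LinearMap.mk₂ ℝ (fun u w => S.webster y (tangentCoordSymm p y u) (tangentCoordSymm p y w))
    (fun _ _ _ => by simp only [webster_eq, map_add, add_apply]; ring)
    (fun _ _ _ => by simp only [webster_eq, map_smul, smul_apply, smul_eq_mul]; ring)
    (fun _ _ _ => by simp only [webster_eq, map_add]; ring)
    (fun _ _ _ => by simp only [webster_eq, map_smul, smul_eq_mul]; ring)).toContinuousBilinearMap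

lemma websterCoord_apply (p y : M) (u w : EuclideanSpace ℝ (Fin (2 * n + 1))) :
    S.websterCoord p y u w = S.webster y (coordField p u y) (coordField p w y) := rfl

lemma continuousAt_websterCoord (p : M) : ContinuousAt (S.websterCoord p) p := by
  refine continuousAt_clm_apply.2 fun u => continuousAt_clm_apply.2 fun w => ?_
  have hp := mem_chart_source (EuclideanSpace ℝ (Fin (2 * n + 1))) p
  exact (S.contMDiffAt_webster (contMDiffFieldAt_coordField hp u)
    (contMDiffFieldAt_coordField hp w)).continuousAt

/-- At `p` the bound is the minimum of a positive form over the unit sphere; by continuity half of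
it survives nearby. It converts a bound on the conserved Webster norm into one on coordinates. -/
lemma eventually_norm_sq_le_webster (p : M) : ∃ m > (0 : ℝ), ∀ᶠ y in 𝓝 p,
    ∀ v : TangentSpace (𝓡 (2 * n + 1)) y, m * ‖tangentCoord p y v‖ ^ 2 ≤ S.webster y v v := by
  have hp := mem_chart_source (EuclideanSpace ℝ (Fin (2 * n + 1))) p
  have hpos : ∀ u ∈ Metric.sphere (0 : EuclideanSpace ℝ (Fin (2 * n + 1))) 1,
      0 < S.websterCoord p p u u := fun u hu => by
    refine S.webster_pos p fun h => ?_
    have := congrArg (tangentCoord p p) h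
    rw [map_zero] at this
    have hu0 : u = 0 := (tangentCoord_symm hp u).symm.trans this
    simp [hu0] at hu
  obtain ⟨m, hm, hmin⟩ := (isCompact_sphere (0 : EuclideanSpace ℝ (Fin (2 * n + 1))) 1).exists_forall_le'
    (f := fun u => S.websterCoord p p u u) (by fun_prop) hpos
  refine ⟨m / 2, by positivity, ?_⟩
  filter_upwards [(S.continuousAt_websterCoord p).eventually
    (Metric.ball_mem_nhds _ (half_pos hm)), (chartAt _ p).open_source.mem_nhds hp] with y hy hys v
  set u := tangentCoord p y v
  have hv : S.webster y v v = S.websterCoord p y u u := by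
    rw [websterCoord_apply, coordField, tangentCoordSymm_coord hys]
  have h1 : m * ‖u‖ ^ 2 ≤ S.websterCoord p p u u := by
    by_cases hu : u = 0
    · simp [hu]
    · have h := hmin (‖u‖⁻¹ • u) (by simp [norm_smul, hu])
      simp only [map_smul, smul_apply, smul_eq_mul] at h
      have hn : 0 < ‖u‖ := norm_pos_iff.2 hu
      calc m * ‖u‖ ^ 2 ≤ (‖u‖⁻¹ * (‖u‖⁻¹ * S.websterCoord p p u u)) * ‖u‖ ^ 2 := by gcongr
        _ = _ := by field_simp
  have h2 : |S.websterCoord p y u u - S.websterCoord p p u u| ≤ m / 2 * ‖u‖ ^ 2 := by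
    have := (S.websterCoord p y - S.websterCoord p p).le_opNorm₂ u u
    simp only [sub_apply, Real.norm_eq_abs] at this
    refine this.trans ?_
    rw [mul_assoc, ← sq]
    gcongr
    exact (mem_ball_iff_norm.1 hy).le
  rw [hv]
  linarith [(abs_le.1 h2).1]

variable {S}
variable {cov : CovariantDerivative (𝓡 (2 * n + 1)) (EuclideanSpace ℝ (Fin (2 * n + 1)))
      (fun x : M => TangentSpace (𝓡 (2 * n + 1)) x)}

omit S in
-- This form of the geodesic equation makes the acceleration cancel the derivative of a parallel
-- tensor in the two conservation laws.
lemma _root_.IsGeodesicAt.hasDerivAt_deriv {γ : ℝ → M} {t : ℝ} (h : IsGeodesicAt cov γ t) {p : M}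
    (ht : γ t ∈ (chartAt (EuclideanSpace ℝ (Fin (2 * n + 1))) p).source) :
    ∃ a, HasDerivAt (deriv fun s => extChartAt (𝓡 (2 * n + 1)) p (γ s)) a t ∧
      tangentCoordSymm p (γ t) a = - cov (coordField p
        (deriv (fun s => extChartAt (𝓡 (2 * n + 1)) p (γ s)) t)) (γ t) (velocity γ t) := by
  refine ⟨_, (h.hasDerivAt_chartJet ht).snd, ?_⟩
  have : (extChartAt (𝓡 (2 * n + 1)) p).symm (extChartAt (𝓡 (2 * n + 1)) p (γ t)) = γ t :=
    (extChartAt (𝓡 (2 * n + 1)) p).left_inv (by simpa using ht)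
  simp only [geodesicField, chartJet, this]
  rw [map_neg, christoffel, tangentCoordSymm_coord ht, ← velocity_eq h.mdifferentiableAt ht]

variable [T2Space M]

lemma IsTanakaWebster.hasDerivAt_websterCoord (h : S.IsTanakaWebster cov) {γ : ℝ → M} {t : ℝ}
    (hγ : MDifferentiableAt 𝓘(ℝ, ℝ) (𝓡 (2 * n + 1)) γ t) {p : M}
    (ht : γ t ∈ (chartAt (EuclideanSpace ℝ (Fin (2 * n + 1))) p).source)  :
    ∃ B, HasDerivAt (fun s => S.websterCoord p (γ s)) B t ∧ ∀ u w, B u w =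
      S.webster (γ t) (cov (coordField p u) (γ t) (velocity γ t)) (coordField p w (γ t))
        + S.webster (γ t) (coordField p u (γ t)) (cov (coordField p w) (γ t) (velocity γ t)) := by
  have hd : ∀ u w, HasDerivAt (fun s => S.websterCoord p (γ s) u w) (
      S.webster (γ t) (cov (coordField p u) (γ t) (velocity γ t)) (coordField p w (γ t))
        + S.webster (γ t) (coordField p u (γ t)) (cov (coordField p w) (γ t) (velocity γ t))) t := by
    intro u w
    rw [← h.mvfderiv_webster (eventually_contMDiffFieldAt_coordField ht u)
      (eventually_contMDiffFieldAt_coordField ht w)]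
    exact hasDerivAt_comp_velocity ((S.contMDiffAt_webster (contMDiffFieldAt_coordField ht u)
      (contMDiffFieldAt_coordField ht w)).mdifferentiableAt (by simp)) hγ
  have hB : DifferentiableAt ℝ (fun s => S.websterCoord p (γ s)) t :=
    differentiableAt_of_clm_apply fun u => differentiableAt_of_clm_apply fun w =>
      (hd u w).differentiableAt
  refine ⟨_, hB.hasDerivAt, fun u w => ?_⟩
  have := (hB.hasDerivAt.clm_apply (hasDerivAt_const t u)).clm_apply (hasDerivAt_const t w)
  simpa using this.unique (hd u w)

/-- The Webster norm of the velocity of a geodesic is constant. -/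
lemma IsTanakaWebster.hasDerivAt_webster_velocity (h : S.IsTanakaWebster cov) {γ : ℝ → M} {t : ℝ}
    (hγ : ∀ᶠ s in 𝓝 t, IsGeodesicAt cov γ s) :
    HasDerivAt (fun s => S.webster (γ s) (velocity γ s) (velocity γ s)) 0 t := by
  have ht := mem_chart_source (EuclideanSpace ℝ (Fin (2 * n + 1))) (γ t)
  have hg := hγ.self_of_nhds
  obtain ⟨B, hB, hBa⟩ := h.hasDerivAt_websterCoord hg.mdifferentiableAt ht
  obtain ⟨a, ha, ha'⟩ := hg.hasDerivAt_deriv ht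
  have key := (hB.clm_apply ha).clm_apply ha
  have hev : (fun s => S.webster (γ s) (velocity γ s) (velocity γ s)) =ᶠ[𝓝 t] fun s =>
      S.websterCoord (γ t) (γ s) (deriv (fun s => extChartAt (𝓡 (2 * n + 1)) (γ t) (γ s)) s)
        (deriv (fun s => extChartAt (𝓡 (2 * n + 1)) (γ t) (γ s)) s) := by
    filter_upwards [hγ, hg.1.continuousAt.eventually
      ((chartAt _ (γ t)).open_source.mem_nhds ht)] with s hs hs'
    rw [websterCoord_apply, coordField, ← velocity_eq hs.mdifferentiableAt hs']
  refine (key.congr_of_eventuallyEq hev).congr_deriv ?_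
  -- The derivative of the metric contributes `∇` of the constant field in each slot, and `ha'`
  -- contributes its negative.
  simp only [add_apply, hBa, websterCoord_apply]
  rw [coordField, coordField, ha']
  simp only [webster_eq, map_neg, neg_apply]
  ring

/-- The same cancellation, with `∇θ = 0` in place of `∇g_θ = 0`. -/
lemma IsTanakaWebster.hasDerivAt_form_velocity (h : S.IsTanakaWebster cov) {γ : ℝ → M} {t : ℝ}
    (hγ : ∀ᶠ s in 𝓝 t, IsGeodesicAt cov γ s) :
    HasDerivAt (fun s => S.form (γ s) (velocity γ s)) 0 t := by
  have ht := mem_chart_source (EuclideanSpace ℝ (Fin (2 * n + 1))) (γ t)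
  have hg := hγ.self_of_nhds
  have hd : ∀ u, HasDerivAt (fun s => (S.form (γ s) ∘L tangentCoordSymm (γ t) (γ s)) u)
      (S.form (γ t) (cov (coordField (γ t) u) (γ t) (velocity γ t))) t := by
    intro u
    rw [← h.mvfderiv_form (eventually_contMDiffFieldAt_coordField ht u)]
    exact hasDerivAt_comp_velocity ((S.contMDiffAt_form_apply le_rfl
      (contMDiffFieldAt_coordField ht u)).mdifferentiableAt (by simp)) hg.mdifferentiableAt
  have hB := (differentiableAt_of_clm_apply fun u => (hd u).differentiableAt).hasDerivAt
  obtain ⟨a, ha, ha'⟩ := hg.hasDerivAt_deriv ht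
  have key := hB.clm_apply ha
  have hev : (fun s => S.form (γ s) (velocity γ s)) =ᶠ[𝓝 t] fun s =>
      (S.form (γ s) ∘L tangentCoordSymm (γ t) (γ s))
        (deriv (fun s => extChartAt (𝓡 (2 * n + 1)) (γ t) (γ s)) s) := by
    filter_upwards [hγ, hg.1.continuousAt.eventually
      ((chartAt _ (γ t)).open_source.mem_nhds ht)] with s hs hs'
    rw [ContinuousLinearMap.comp_apply, ← velocity_eq hs.mdifferentiableAt hs']
  refine (key.congr_of_eventuallyEq hev).congr_deriv ?_
  have h1 := (hB.clm_apply (hasDerivAt_const t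
    (deriv (fun s => extChartAt (𝓡 (2 * n + 1)) (γ t) (γ s)) t))).unique (hd _)
  simp only [map_zero, add_zero] at h1
  rw [h1, ContinuousLinearMap.comp_apply, ha', map_neg, add_neg_cancel]

lemma IsTanakaWebster.webster_velocity_eq (h : S.IsTanakaWebster cov) {γ : ℝ → M} {s : Set ℝ}
    (hs : IsOpen s) (hs' : IsPreconnected s) (hγ : ∀ t ∈ s, IsGeodesicAt cov γ t) {a b : ℝ}
    (ha : a ∈ s) (hb : b ∈ s) : S.webster (γ a) (velocity γ a) (velocity γ a)
      = S.webster (γ b) (velocity γ b) (velocity γ b) := by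
  have hd := fun t (ht : t ∈ s) =>
    h.hasDerivAt_webster_velocity (eventually_of_mem (hs.mem_nhds ht) hγ)
  exact hs.is_const_of_deriv_eq_zero hs' (f := fun s => S.webster (γ s) (velocity γ s) (velocity γ s))
    (fun t ht => (hd t ht).differentiableAt.differentiableWithinAt) (fun t ht => (hd t ht).deriv) ha hb

lemma IsTanakaWebster.form_velocity_eq (h : S.IsTanakaWebster cov) {γ : ℝ → M} {s : Set ℝ}
    (hs : IsOpen s) (hs' : IsPreconnected s) (hγ : ∀ t ∈ s, IsGeodesicAt cov γ t) {a b : ℝ}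
    (ha : a ∈ s) (hb : b ∈ s) : S.form (γ a) (velocity γ a) = S.form (γ b) (velocity γ b) := by
  have hd := fun t (ht : t ∈ s) =>
    h.hasDerivAt_form_velocity (eventually_of_mem (hs.mem_nhds ht) hγ)
  exact hs.is_const_of_deriv_eq_zero hs' (f := fun s => S.form (γ s) (velocity γ s))
    (fun t ht => (hd t ht).differentiableAt.differentiableWithinAt) (fun t ht => (hd t ht).deriv) ha hb

/-- On a compact manifold, geodesics with bounded initial velocity exist for a uniform time. -/
lemma IsTanakaWebster.exists_uniform_time [CompactSpace M] (h : S.IsTanakaWebster cov) (R : ℝ) :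
    ∃ ε > (0 : ℝ), ∀ (q : M) (v : TangentSpace (𝓡 (2 * n + 1)) q), S.webster q v v ≤ R →
      ∃ γ : ℝ → M, (∀ t ∈ Ioo (-ε) ε, IsGeodesicAt cov γ t) ∧
        (⟨γ 0, velocity γ 0⟩ : TangentBundle (𝓡 (2 * n + 1)) M) = ⟨q, v⟩ := by
  let P : Set M → Prop := fun A => ∃ ε > (0 : ℝ), ∀ q ∈ A,
    ∀ v : TangentSpace (𝓡 (2 * n + 1)) q, S.webster q v v ≤ R →
      ∃ γ : ℝ → M, (∀ t ∈ Ioo (-ε) ε, IsGeodesicAt cov γ t) ∧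
        (⟨γ 0, velocity γ 0⟩ : TangentBundle (𝓡 (2 * n + 1)) M) = ⟨q, v⟩
  suffices P univ by
    obtain ⟨ε, hε, H⟩ := this
    exact ⟨ε, hε, fun q => H q (mem_univ q)⟩
  refine isCompact_univ.induction_on (p := P) ⟨1, one_pos, by simp⟩ ?_ ?_ fun p _ => ?_
  · rintro A B hAB ⟨ε, hε, H⟩
    exact ⟨ε, hε, fun q hq => H q (hAB hq)⟩
  · rintro A B ⟨ε, hε, H⟩ ⟨ε', hε', H'⟩
    refine ⟨min ε ε', lt_min hε hε', fun q hq v hv => ?_⟩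
    have hl : Ioo (-min ε ε') (min ε ε') ⊆ Ioo (-ε) ε :=
      Ioo_subset_Ioo (by simp) (by simp)
    have hr : Ioo (-min ε ε') (min ε ε') ⊆ Ioo (-ε') ε' :=
      Ioo_subset_Ioo (by simp) (by simp)
    rcases hq with hq | hq
    · obtain ⟨γ, hγ, h0⟩ := H q hq v hv
      exact ⟨γ, fun t ht => hγ t (hl ht), h0⟩
    · obtain ⟨γ, hγ, h0⟩ := H' q hq v hv
      exact ⟨γ, fun t ht => hγ t (hr ht), h0⟩
  · obtain ⟨m, hm, hmw⟩ := S.eventually_norm_sq_le_webster p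
    -- From `m‖u‖² ≤ g_θ(v, v) ≤ R`, the coordinate norm is at most `√(R / m)`.
    obtain ⟨ε, hε, H⟩ := exists_geodesic_of_norm_le h.smooth p (Real.sqrt (R / m))
    have hp := mem_chart_source (EuclideanSpace ℝ (Fin (2 * n + 1))) p
    refine ⟨_, mem_nhdsWithin_of_mem_nhds (hmw.and (H.and ((chartAt _ p).open_source.mem_nhds hp))),
      ε, hε, ?_⟩
    rintro q ⟨hq1, hq2, hq3⟩ v hv
    obtain ⟨γ, hγ, h0⟩ := hq2 (tangentCoord p q v) (Real.le_sqrt_of_sq_le (by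
      rw [le_div_iff₀ hm]; linarith [hq1 v]))
    exact ⟨γ, hγ, by rw [h0, tangentCoordSymm_coord hq3]⟩

end PseudohermitianStructure


/-! ### Gluing and indefinite extension of geodesics. -/

section Extension

variable {n : ℕ} {M : Type*} [TopologicalSpace M]
  [ChartedSpace (EuclideanSpace ℝ (Fin (2 * n + 1))) M]
  [IsManifold (𝓡 (2 * n + 1)) ∞ M]
  {cov : CovariantDerivative (𝓡 (2 * n + 1)) (EuclideanSpace ℝ (Fin (2 * n + 1)))
      (fun x : M => TangentSpace (𝓡 (2 * n + 1)) x)}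

/-- The velocity of a curve as a point of the tangent bundle. -/
abbrev tangentLift (γ : ℝ → M) (t : ℝ) : TangentBundle (𝓡 (2 * n + 1)) M := ⟨γ t, velocity γ t⟩

omit [IsManifold (𝓡 (2 * n + 1)) ∞ M] in
lemma tangentLift_congr {γ γ' : ℝ → M} {t : ℝ} (h : γ =ᶠ[𝓝 t] γ') :
    tangentLift (n := n) γ t = tangentLift γ' t := by
  have h1 : ∀ a b : M, a = b → ∀ v : EuclideanSpace ℝ (Fin (2 * n + 1)),
      (⟨a, v⟩ : TangentBundle (𝓡 (2 * n + 1)) M) = ⟨b, v⟩ := by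
    rintro a _ rfl v; rfl
  have h2 : (velocity (n := n) γ t : EuclideanSpace ℝ (Fin (2 * n + 1))) = velocity (n := n) γ' t :=
    congrArg (fun L : ℝ →L[ℝ] EuclideanSpace ℝ (Fin (2 * n + 1)) => L 1)
      (h.mfderiv_eq (I := 𝓘(ℝ, ℝ)) (I' := 𝓡 (2 * n + 1)))
  refine (h1 _ _ h.self_of_nhds _).trans ?_
  exact congrArg (fun v : EuclideanSpace ℝ (Fin (2 * n + 1)) =>
    (⟨γ' t, v⟩ : TangentBundle (𝓡 (2 * n + 1)) M)) h2

lemma tangentLift_comp_affine {γ : ℝ → M} {c d t : ℝ} (h : IsGeodesicAt cov γ (c * t + d)) :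
    tangentLift (n := n) (fun s => γ (c * s + d)) t = ⟨γ (c * t + d), c • velocity γ (c * t + d)⟩ :=
  congrArg (fun v => (⟨γ (c * t + d), v⟩ : TangentBundle (𝓡 (2 * n + 1)) M))
    (velocity_comp_affine h.mdifferentiableAt)

variable [T2Space M]

/-- Two geodesics which are tangent at one point can be glued. -/
lemma exists_geodesic_union (hcov : CovariantDerivative.ContMDiffCovariantDerivative cov ∞)
    {γ γ' : ℝ → M} {s s' : Set ℝ} (hs : IsOpen s) (hs' : IsOpen s') (hc : IsPreconnected (s ∩ s'))
    (h : ∀ t ∈ s, IsGeodesicAt cov γ t) (h' : ∀ t ∈ s', IsGeodesicAt cov γ' t) {t₀ : ℝ}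
    (ht₀ : t₀ ∈ s ∩ s') (hjet : tangentLift (n := n) γ t₀ = tangentLift γ' t₀) :
    ∃ β : ℝ → M, (∀ t ∈ s ∪ s', IsGeodesicAt cov β t) ∧ EqOn β γ s := by
  classical
  have heq : EqOn γ γ' (s ∩ s') := eqOn_of_isGeodesicAt hcov hc (hs.inter hs')
    (fun t ht => h t ht.1) (fun t ht => h' t ht.2) ht₀ hjet
  have h1 : EqOn (s.piecewise γ γ') γ s := fun t ht => piecewise_eq_of_mem _ _ _ ht
  have h2 : EqOn (s.piecewise γ γ') γ' s' := fun t ht => by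
    by_cases hts : t ∈ s
    · rw [h1 hts, heq ⟨hts, ht⟩]
    · exact piecewise_eq_of_notMem _ _ _ hts
  refine ⟨s.piecewise γ γ', ?_, h1⟩
  rintro t (ht | ht)
  · exact (h t ht).congr (h1.eventuallyEq_of_mem (hs.mem_nhds ht))
  · exact (h' t ht).congr (h2.eventuallyEq_of_mem (hs'.mem_nhds ht))

/-- A geodesic on an interval extends by `ε / 2` on both sides if geodesics tangent to it exist for
time `ε`. -/
lemma exists_geodesic_extension (hcov : CovariantDerivative.ContMDiffCovariantDerivative cov ∞)
    {ε a : ℝ} (hε : 0 < ε) (ha : ε ≤ a) {γ : ℝ → M} (hγ : ∀ t ∈ Ioo (-a) a, IsGeodesicAt cov γ t)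
    (hext : ∀ t ∈ Ioo (-a) a, ∃ β : ℝ → M, (∀ t ∈ Ioo (-ε) ε, IsGeodesicAt cov β t) ∧
      tangentLift (n := n) β 0 = tangentLift γ t) :
    ∃ β : ℝ → M, (∀ t ∈ Ioo (-(a + ε / 2)) (a + ε / 2), IsGeodesicAt cov β t) ∧
      EqOn β γ (Ioo (-a) a) := by
  have hstep : ∀ t₀ ∈ Ioo (-a) a, ∃ δ : ℝ → M,
      (∀ t ∈ Ioo (t₀ - ε) (t₀ + ε), IsGeodesicAt cov δ t) ∧
      tangentLift (n := n) δ t₀ = tangentLift γ t₀ := by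
    intro t₀ ht₀
    obtain ⟨β, hβ, h0⟩ := hext t₀ ht₀
    have hmem : ∀ t ∈ Ioo (t₀ - ε) (t₀ + ε), 1 * t + -t₀ ∈ Ioo (-ε) ε := fun t ht =>
      ⟨by linarith [ht.1], by linarith [ht.2]⟩
    refine ⟨fun s => β (1 * s + -t₀), fun t ht => (hβ _ (hmem t ht)).comp_affine, ?_⟩
    rw [tangentLift_comp_affine (hβ _ (hmem t₀ ⟨by linarith, by linarith⟩)), one_smul, ← h0]
    have : 1 * t₀ + -t₀ = 0 := by ring
    rw [this]
  have hpre : ∀ {c d c' d' : ℝ}, IsPreconnected (Ioo c d ∩ Ioo c' d') := by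
    intros; rw [Ioo_inter_Ioo]; exact isPreconnected_Ioo
  -- A geodesic of duration `ε` attached at distance `ε / 2` inside each end reaches `ε / 2` beyond
  -- it.
  have hr : a - ε / 2 ∈ Ioo (-a) a := ⟨by linarith, by linarith⟩
  have hl : -(a - ε / 2) ∈ Ioo (-a) a := ⟨by linarith, by linarith⟩
  obtain ⟨δ, hδ, hδ0⟩ := hstep _ hr
  obtain ⟨β, hβ, hβγ⟩ := exists_geodesic_union hcov isOpen_Ioo isOpen_Ioo hpre hγ hδ
    ⟨hr, by linarith, by linarith⟩ hδ0.symm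
  have hβ' : ∀ t ∈ Ioo (-a) (a + ε / 2), IsGeodesicAt cov β t := fun t ht => by
    refine hβ t ?_
    rcases lt_or_ge t a with h | h
    · exact .inl ⟨ht.1, h⟩
    · exact .inr ⟨by linarith, by linarith [ht.2]⟩
  obtain ⟨δ', hδ', hδ'0⟩ := hstep _ hl
  have hl' : -(a - ε / 2) ∈ Ioo (-a) (a + ε / 2) := ⟨by linarith, by linarith⟩
  obtain ⟨β', hβ'', hββ'⟩ := exists_geodesic_union hcov isOpen_Ioo isOpen_Ioo hpre hβ' hδ'
    ⟨hl', by linarith, by linarith⟩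
    ((tangentLift_congr (hβγ.eventuallyEq_of_mem (isOpen_Ioo.mem_nhds hl))).trans hδ'0.symm)
  refine ⟨β', fun t ht => hβ'' t ?_, fun t ht => ?_⟩
  · rcases lt_or_ge (-a) t with h | h
    · exact .inl ⟨h, ht.2⟩
    · exact .inr ⟨by linarith [ht.1], by linarith⟩
  · rw [hββ' ⟨ht.1, by linarith [ht.2]⟩, hβγ ht]

/-- Geodesics with initial velocity in a set of tangent vectors which is preserved by the geodesic
flow are defined on `ℝ` if they exist for a uniform time. -/
theorem exists_isGeodesicFrom (hcov : CovariantDerivative.ContMDiffCovariantDerivative cov ∞)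
    {K : Set (TangentBundle (𝓡 (2 * n + 1)) M)} {ε : ℝ} (hε : 0 < ε)
    (hext : ∀ z ∈ K, ∃ β : ℝ → M, (∀ t ∈ Ioo (-ε) ε, IsGeodesicAt cov β t) ∧
      tangentLift β 0 = z)
    (hinv : ∀ (γ : ℝ → M) (a : ℝ), (∀ t ∈ Ioo (-a) a, IsGeodesicAt cov γ t) →
      tangentLift γ 0 ∈ K → ∀ t ∈ Ioo (-a) a, tangentLift γ t ∈ K)
    {x : M} {w : TangentSpace (𝓡 (2 * n + 1)) x} (hw : ⟨x, w⟩ ∈ K) :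
    ∃ γ : ℝ → M, IsGeodesicFrom cov x w γ := by
  have hN : ∀ N : ℕ, ∃ γ : ℝ → M, (∀ t ∈ Ioo (-(ε + N * (ε / 2))) (ε + N * (ε / 2)),
      IsGeodesicAt cov γ t) ∧ tangentLift (n := n) γ 0 = ⟨x, w⟩ := by
    intro N
    induction N with
    | zero => simpa using hext _ hw
    | succ N ih =>
      obtain ⟨γ, hγ, h0⟩ := ih
      have hpos : 0 < ε + N * (ε / 2) := by positivity
      obtain ⟨β, hβ, hβγ⟩ := exists_geodesic_extension hcov hε
        (le_add_of_nonneg_right (by positivity)) hγ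
        fun t ht => hext _ (hinv γ _ hγ (by rw [h0]; exact hw) t ht)
      refine ⟨β, fun t ht => hβ t ?_, ?_⟩
      · have e : ε + ((N + 1 : ℕ) : ℝ) * (ε / 2) = ε + N * (ε / 2) + ε / 2 := by push_cast; ring
        rwa [e] at ht
      · rw [← h0]
        exact tangentLift_congr (hβγ.eventuallyEq_of_mem
          (isOpen_Ioo.mem_nhds ⟨by linarith, hpos⟩))
  choose γ hγ h0 using hN
  have hagree : ∀ N N' : ℕ, N ≤ N' →
      EqOn (γ N) (γ N') (Ioo (-(ε + N * (ε / 2))) (ε + N * (ε / 2))) := by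
    intro N N' hNN'
    have hle : (N : ℝ) * (ε / 2) ≤ N' * (ε / 2) := by gcongr
    have hpos : 0 < ε + N * (ε / 2) := by positivity
    refine eqOn_of_isGeodesicAt hcov isPreconnected_Ioo isOpen_Ioo (hγ N)
      (fun t ht => hγ N' t ⟨by linarith [ht.1], by linarith [ht.2]⟩) (t₀ := 0)
      ⟨by linarith, hpos⟩ ((h0 N).trans (h0 N').symm)
  have hex : ∀ t : ℝ, ∃ N : ℕ, t ∈ Ioo (-(ε + N * (ε / 2))) (ε + N * (ε / 2)) := by
    intro t
    obtain ⟨N, hN⟩ := exists_nat_gt (|t| / (ε / 2))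
    rw [div_lt_iff₀ (by positivity)] at hN
    have := abs_lt.1 (hN.trans (lt_add_of_pos_left _ hε))
    exact ⟨N, this.1, this.2⟩
  -- The global curve reads its value at `t` from stage `k t`; `hagree` makes the choice immaterial.
  choose k hk using hex
  have hloc : ∀ N, EqOn (fun t => γ (k t) t) (γ N) (Ioo (-(ε + N * (ε / 2))) (ε + N * (ε / 2))) := by
    intro N t ht
    rcases le_total N (k t) with h | h
    · exact (hagree _ _ h ht).symm
    · exact hagree _ _ h (hk t)
  have hev : ∀ t, (fun t => γ (k t) t) =ᶠ[𝓝 t] γ (k t) := fun t =>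
    (hloc (k t)).eventuallyEq_of_mem (isOpen_Ioo.mem_nhds (hk t))
  refine ⟨fun t => γ (k t) t, (isGeodesicOn_iff cov isOpen_univ).2 fun t _ =>
    (hγ (k t) t (hk t)).congr (hev t), ?_⟩
  exact (tangentLift_congr (hev 0)).trans (h0 (k 0))

end Extension

/-! ### Completeness. -/

namespace PseudohermitianStructure
variable {n : ℕ} {M : Type*} [TopologicalSpace M]
  [ChartedSpace (EuclideanSpace ℝ (Fin (2 * n + 1))) M]
  [IsManifold (𝓡 (2 * n + 1)) ∞ M] {S : PseudohermitianStructure n M}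
  {cov : CovariantDerivative (𝓡 (2 * n + 1)) (EuclideanSpace ℝ (Fin (2 * n + 1)))
      (fun x : M => TangentSpace (𝓡 (2 * n + 1)) x)} [T2Space M]

/-- The Tanaka-Webster connection of a compact manifold is complete. -/
theorem IsTanakaWebster.existsUnique_isGeodesicFrom [CompactSpace M] (h : S.IsTanakaWebster cov)
    (x : M) (w : TangentSpace (𝓡 (2 * n + 1)) x) : ∃! γ : ℝ → M, IsGeodesicFrom cov x w γ := by
  refine existsUnique_of_exists_of_unique ?_ fun γ γ' hγ hγ' => ?_
  -- The invariant set is the sublevel set of the Webster norm at the value for `w`; conservation of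
  -- speed keeps the velocity in it.
  · obtain ⟨ε, hε, H⟩ := h.exists_uniform_time (S.webster x w w)
    refine exists_isGeodesicFrom h.smooth
      (K := {z | S.webster z.1 z.2 z.2 ≤ S.webster x w w}) hε (fun z hz => H z.1 z.2 hz) ?_ (mem_ofPred.2 le_rfl)
    intro γ a hγ h0 t ht
    have hpos : 0 < a := by linarith [ht.1, ht.2]
    exact (h.webster_velocity_eq isOpen_Ioo isPreconnected_Ioo hγ ht
      ⟨by linarith, hpos⟩).trans_le h0
  · have h1 := (isGeodesicOn_iff cov isOpen_univ).1 hγ.1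
    have h2 := (isGeodesicOn_iff cov isOpen_univ).1 hγ'.1
    exact funext fun t => eqOn_of_isGeodesicAt h.smooth isPreconnected_univ isOpen_univ h1 h2
      (mem_univ 0) (hγ.2.trans hγ'.2.symm) (mem_univ t)

end PseudohermitianStructure


/-! ### Lengths of horizontal geodesics and the exponential map. -/

namespace PseudohermitianStructure
variable {n : ℕ} {M : Type*} [TopologicalSpace M]
  [ChartedSpace (EuclideanSpace ℝ (Fin (2 * n + 1))) M]
  [IsManifold (𝓡 (2 * n + 1)) ∞ M] (S : PseudohermitianStructure n M)
  {cov : CovariantDerivative (𝓡 (2 * n + 1)) (EuclideanSpace ℝ (Fin (2 * n + 1)))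
      (fun x : M => TangentSpace (𝓡 (2 * n + 1)) x)}

lemma hNorm_smul (x : M) {c : ℝ} (hc : 0 ≤ c) (v : TangentSpace (𝓡 (2 * n + 1)) x) :
    S.hNorm x (c • v) = c * S.hNorm x v := by
  have : S.levi x (c • v) (c • v) = c ^ 2 * S.levi x v v := by
    simp only [levi, dForm_eq_dFormL, map_smul, smul_apply, smul_eq_mul]
    ring
  rw [hNorm, this, Real.sqrt_mul (sq_nonneg c), Real.sqrt_sq hc, hNorm]

lemma hNorm_eq_sqrt_webster {x : M} {v : TangentSpace (𝓡 (2 * n + 1)) x} (hv : S.form x v = 0) :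
    S.hNorm x v = Real.sqrt (S.webster x v v) := by
  rw [hNorm, S.webster_self_of_form_eq_zero hv]

lemma ccDist_le_curveLength {γ : ℝ → M} {a b : ℝ} {x y : M} (hab : a ≤ b)
    (hγ : S.IsLengthyCurve γ a b) (ha : γ a = x) (hb : γ b = y) :
    S.ccDist x y ≤ S.curveLength γ a b :=
  iInf_le_of_le γ <| iInf_le_of_le a <| iInf_le_of_le b <| iInf_le _ ⟨hab, hγ, ha, hb⟩

variable {S} [T2Space M]

/-- The length of a lengthy geodesic of the Tanaka-Webster connection. -/
lemma IsTanakaWebster.curveLength_eq (h : S.IsTanakaWebster cov) {γ : ℝ → M} {s : Set ℝ}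
    (hs : IsOpen s) (hs' : IsPreconnected s) (hγ : ∀ t ∈ s, IsGeodesicAt cov γ t) {a b : ℝ}
    (hab : a ≤ b) (hsub : Icc a b ⊆ s) (hH : S.form (γ a) (velocity γ a) = 0) :
    S.curveLength γ a b = ENNReal.ofReal ((b - a) * S.hNorm (γ a) (velocity γ a)) := by
  have ha : a ∈ s := hsub (left_mem_Icc.2 hab)
  have hconst : ∀ t ∈ Ioo a b, ENNReal.ofReal (S.hNorm (γ t) (velocity γ t))
      = ENNReal.ofReal (S.hNorm (γ a) (velocity γ a)) := fun t ht => by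
    have hts := hsub (Ioo_subset_Icc_self ht)
    rw [S.hNorm_eq_sqrt_webster hH, S.hNorm_eq_sqrt_webster
      ((h.form_velocity_eq hs hs' hγ hts ha).trans hH), h.webster_velocity_eq hs hs' hγ hts ha]
  rw [curveLength, MeasureTheory.setLIntegral_congr_fun measurableSet_Ioo hconst,
    MeasureTheory.setLIntegral_const, Real.volume_Ioo, mul_comm, ENNReal.ofReal_mul (by linarith)]

lemma IsTanakaWebster.isLengthyCurve (h : S.IsTanakaWebster cov) {γ : ℝ → M}
    (hγ : IsGeodesicOn cov γ univ) {t₀ : ℝ} (hH : S.form (γ t₀) (velocity γ t₀) = 0) (a b : ℝ) :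
    S.IsLengthyCurve γ a b := by
  refine ⟨hγ.1.continuousOn.mono (subset_univ _), ⟨∅, fun c d _ _ _ _ =>
    (hγ.1.mono (subset_univ _)).of_le (by norm_num)⟩, fun t _ _ => ?_⟩
  rw [h.form_velocity_eq isOpen_univ isPreconnected_univ
    ((isGeodesicOn_iff cov isOpen_univ).1 hγ) (mem_univ t) (mem_univ t₀), hH]

lemma IsTanakaWebster.expMap_eq [CompactSpace M] (h : S.IsTanakaWebster cov) {x : M}
    {w : TangentSpace (𝓡 (2 * n + 1)) x} {γ : ℝ → M} (hγ : IsGeodesicFrom cov x w γ) :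
    expMap cov x w = γ 1 := by
  have hex : ∃ γ : ℝ → M, IsGeodesicFrom cov x w γ := ⟨γ, hγ⟩
  rw [expMap, dif_pos hex]
  exact congrFun ((h.existsUnique_isGeodesicFrom x w).unique hex.choose_spec hγ) 1

/-- The exponential map does not increase the distance to the base point. -/
lemma IsTanakaWebster.ccDist_expMap_le [CompactSpace M] (h : S.IsTanakaWebster cov) {x : M}
    {w : TangentSpace (𝓡 (2 * n + 1)) x} (hw : S.form x w = 0) :
    S.ccDist x (expMap cov x w) ≤ ENNReal.ofReal (S.hNorm x w) := by
  obtain ⟨γ, hγ, -⟩ := h.existsUnique_isGeodesicFrom x w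
  -- Stated for a general point of the tangent bundle so that the equality of initial data can be
  -- substituted without transport between fibres.
  have hz : ∀ z : TangentBundle (𝓡 (2 * n + 1)) M, z = ⟨x, w⟩ →
      S.form z.1 z.2 = 0 ∧ S.hNorm z.1 z.2 = S.hNorm x w ∧ z.1 = x := by
    rintro _ rfl
    exact ⟨hw, rfl, rfl⟩
  obtain ⟨hH, hN, h0⟩ := hz _ hγ.2
  rw [h.expMap_eq hγ]
  refine (S.ccDist_le_curveLength zero_le_one (h.isLengthyCurve hγ.1 hH 0 1) h0 rfl).trans ?_
  rw [h.curveLength_eq isOpen_univ isPreconnected_univ ((isGeodesicOn_iff cov isOpen_univ).1 hγ.1)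
    zero_le_one (subset_univ _) hH, hN]
  simp

/-- The conservation laws and uniqueness need a connected domain, while a minimizing geodesic is
only given on some open set. -/
lemma _root_.IsOpen.exists_Ioo_subset_of_Icc_subset {s : Set ℝ} (hs : IsOpen s) {a b : ℝ}
    (hab : a ≤ b) (h : Icc a b ⊆ s) : ∃ a' < a, ∃ b' > b, Ioo a' b' ⊆ s := by
  obtain ⟨a', ha', h1⟩ := exists_Ioc_subset_of_mem_nhds (hs.mem_nhds (h (left_mem_Icc.2 hab)))
    (exists_lt a)
  obtain ⟨b', hb', h2⟩ := exists_Ico_subset_of_mem_nhds (hs.mem_nhds (h (right_mem_Icc.2 hab)))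
    (exists_gt b)
  refine ⟨a', ha', b', hb', fun t ht => ?_⟩
  rcases le_or_gt t a with hta | hta
  · exact h1 ⟨ht.1, hta⟩
  rcases le_or_gt t b with htb | htb
  · exact h ⟨hta.le, htb⟩
  · exact h2 ⟨htb.le, ht.2⟩

/-- A point joined to `x` by a minimizing lengthy geodesic is the image under `exp_x` of a
horizontal vector whose length is the distance. -/
lemma IsTanakaWebster.exists_expMap_eq [CompactSpace M] (h : S.IsTanakaWebster cov) {γ : ℝ → M}
    {a b : ℝ} {x y : M} (hγ : IsMinimizingLengthyGeodesic cov S γ a b x y) :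
    ∃ w, S.form x w = 0 ∧ ENNReal.ofReal (S.hNorm x w) = S.ccDist x y ∧ expMap cov x w = y := by
  obtain ⟨hab, ⟨s, hs, hsub, hgeo⟩, hH, rfl, rfl, hlen⟩ := hγ
  obtain ⟨a', ha', b', hb', hI⟩ := hs.exists_Ioo_subset_of_Icc_subset hab hsub
  have hg : ∀ t ∈ Ioo a' b', IsGeodesicAt cov γ t := fun t ht =>
    (isGeodesicOn_iff cov hs).1 hgeo t (hI ht)
  have hHa := hH a (left_mem_Icc.2 hab)
  have hc : 0 ≤ b - a := sub_nonneg.2 hab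
  -- This is the initial velocity of `t ↦ γ((b - a)t + a)`; for `a = b` it is the zero vector.
  refine ⟨(b - a) • velocity γ a, by rw [map_smul, hHa, smul_zero], ?_, ?_⟩
  · rw [← hlen, S.hNorm_smul _ hc, h.curveLength_eq isOpen_Ioo isPreconnected_Ioo hg hab
      (Icc_subset_Ioo ha' hb') hHa]
  · obtain ⟨η, hη, -⟩ := h.existsUnique_isGeodesicFrom (γ a) ((b - a) • velocity γ a)
    -- The reparametrized curve is known to be a geodesic only on `J`, an interval containing `0`
    -- and `1`; uniqueness there identifies it with `η` at time `1`.
    let J : Set ℝ := (fun t => (b - a) * t + a) ⁻¹' Ioo a' b'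
    have hJo : IsOpen J := isOpen_Ioo.preimage (by fun_prop)
    have hJc : IsPreconnected J := by
      refine (ordConnected_Ioo.preimage_mono fun s t hst => ?_).isPreconnected
      gcongr
    have h0 : (b - a) * 0 + a = a := by ring
    have h1 : (b - a) * 1 + a = b := by ring
    have hJ0 : (0 : ℝ) ∈ J := by
      simp only [J, mem_preimage, h0]; exact ⟨ha', hab.trans_lt hb'⟩
    have hJ1 : (1 : ℝ) ∈ J := by
      simp only [J, mem_preimage, h1]; exact ⟨ha'.trans_le hab, hb'⟩
    have hjet : tangentLift (n := n) (fun t => γ ((b - a) * t + a)) 0 = tangentLift η 0 := by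
      rw [tangentLift_comp_affine (hg _ hJ0), h0]
      exact hη.2.symm
    have key := eqOn_of_isGeodesicAt h.smooth hJc hJo (fun t ht => (hg _ ht).comp_affine)
      (fun t _ => (isGeodesicOn_iff cov isOpen_univ).1 hη.1 t (mem_univ t)) hJ0 hjet hJ1
    rw [h.expMap_eq hη, ← key]
    exact congrArg γ h1

end PseudohermitianStructure

end

theorem mainTheorem6 {n : ℕ} {M : Type*} [TopologicalSpace M] [T2Space M] [CompactSpace M]
    [ChartedSpace (EuclideanSpace ℝ (Fin (2 * n + 1))) M]
    [IsManifold (𝓡 (2 * n + 1)) ∞ M]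
    (S : PseudohermitianStructure n M)
    (cov : CovariantDerivative (𝓡 (2 * n + 1)) (EuclideanSpace ℝ (Fin (2 * n + 1)))
      (fun x : M => TangentSpace (𝓡 (2 * n + 1)) x))
    (hcov : S.IsTanakaWebster cov) (hS : S.IsSasakian cov)
    (c : ℝ) (hc : 0 < c) (x₀ : M)
    (hmin : ∀ x ∈ S.ccBall x₀ (Real.pi / Real.sqrt c), ∃ (γ : ℝ → M) (a b : ℝ),
      IsMinimizingLengthyGeodesic cov S γ a b x₀ x) :
    (∀ w ∈ S.hDisc x₀ (Real.pi / Real.sqrt c), ∃! γ : ℝ → M, IsGeodesicFrom cov x₀ w γ) ∧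
    MapsTo (expMap cov x₀) (S.hDisc x₀ (Real.pi / Real.sqrt c))
      (S.ccBall x₀ (Real.pi / Real.sqrt c)) ∧
    SurjOn (expMap cov x₀) (S.hDisc x₀ (Real.pi / Real.sqrt c))
      (S.ccBall x₀ (Real.pi / Real.sqrt c)) := by
  refine ⟨fun w _ => hcov.existsUnique_isGeodesicFrom x₀ w, fun w hw => ?_, fun x hx => ?_⟩
  · exact (hcov.ccDist_expMap_le hw.1).trans_lt
      ((ENNReal.ofReal_lt_ofReal_iff_of_nonneg (Real.sqrt_nonneg _)).2 hw.2)
  · obtain ⟨γ, a, b, hγ⟩ := hmin x hx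
    obtain ⟨w, hw, hlen, hexp⟩ := hcov.exists_expMap_eq hγ
    refine ⟨w, ⟨hw, ?_⟩, hexp⟩
    -- Since `|w| = ρ(x₀, x)`, membership of `x` in the open ball is exactly membership of `w` in
    -- the open disc.
    refine (ENNReal.ofReal_lt_ofReal_iff_of_nonneg (Real.sqrt_nonneg _)).1 ?_
    exact hlen.trans_lt hx
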